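/- Let $1\le p<\infty$, let $\mathbf W$ be a Borel probability measure on $[0,\infty)$, and for $n\in\mathbb N=\{1,2,\dots\}$ let $\mathbb B_p^n=\{x\in\mathbb R^n:\|x\|_p\le 1\}$, where $\|x\|_p=(\sum_{i=1}^n|x_i|^p)^{1/p}$. Let $\mathbf U_{n,p}$ be the uniform distribution on $\mathbb B_p^n$ and let $\mathbf C_{n,p}$ be the cone probability measure, carried by the sphere $\{\|x\|_p=1\}$ and given there by $\mathbf C_{n,p}(A)=|\{rx: x\in A,\ r\in[0,1]\}|/|\mathbb B_p^n|$. Put $$\mathbf P_{n,p,\mathbf W}=\mathbf W(\{0\})\,\mathbf C_{n,p}+H\,\mathbf U_{n,p},$$ where $H(x)=h(\|x\|_p)$ and $$h(r)=\frac{1}{\Gamma(1+\frac np)}\,\frac{1}{(1-r^p)^{1+n/p}}\int_0^\infty s^{n/p}e^{-r^ps/(1-r^p)}\,\mathbf W(\mathrm ds).$$ Let $k_n\in\{1,\dots,n\}$ for $n\in\mathbb N$. On a common probability space let, for each $n$, $X_n$ be a random vector in $\mathbb R^n$ with law $\mathbf P_{n,p,\mathbf W}$, and let $E_n$ be a random $k_n$-dimensional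 linear subspace of $\mathbb R^n$, independent of $X_n$, whose law is the Haar (rotation invariant) probability measure $\nu_{n,k_n}$ on the Grassmannian, i.e. the image of the Haar probability measure on $O(n)$ under $T\mapsto T\,\mathrm{span}(e_1,\dots,e_{k_n})$. Write $P_E$ for the orthogonal projection onto $E$. If $k_n\to\infty$ and $k_n/n\to\lambda\in[0,1]$ as $n\to\infty$, then $$n^{1/p}\sqrt{\frac{\Gamma(\frac1p)}{p^{2/p}\,\Gamma(\frac3p)}}\;\|P_{E_n}X_n\|_2-\sqrt{k_n}\ \xrightarrow{\ d\ }\ N,$$ where $N$ is a centered Gaussian random variable with variance $$\sigma^2(p,\lambda)=\frac\lambda4\,\frac{\Gamma(\frac1p)\,\Gamma(\frac5p)}{\Gamma(\frac3p)^2}-\lambda\Big(\frac34+\frac1p\Big)+\frac12\ \ge 0$$ (if $\sigma^2(p,\lambda)=0$, then $N=0$ almost surely). -/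

import Mathlib

open MeasureTheory ProbabilityTheory Filter Topology
open scoped NNReal ENNReal

noncomputable section

/-! ### The `ℓ_p`-balls and the measures on them -/

/-- The `ℓ_p`-norm of a vector of `ℝⁿ`, for a finite exponent `p`. The ambient space carries the
Euclidean norm, so the `ℓ_p`-norm is written out. -/
def ellNorm {n : ℕ} (p : ℝ) (x : EuclideanSpace ℝ (Fin n)) : ℝ :=
  (∑ i, |x i| ^ p) ^ (1 / p)

/-- The closed unit ball `B_p^n` of the `ℓ_p`-norm. -/
def lpBall (n : ℕ) (p : ℝ) : Set (EuclideanSpace ℝ (Fin n)) := {x | ellNorm p x ≤ 1}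

/-- The unit sphere `S_p^{n-1}` of the `ℓ_p`-norm. -/
def lpSphere (n : ℕ) (p : ℝ) : Set (EuclideanSpace ℝ (Fin n)) := {x | ellNorm p x = 1}

/-- The uniform distribution `U_{n,p}` on `B_p^n`: Lebesgue measure conditioned on the ball. -/
def lpUniform (n : ℕ) (p : ℝ) : Measure (EuclideanSpace ℝ (Fin n)) :=
  ProbabilityTheory.cond volume (lpBall n p)

/-- The cone probability measure `C_{n,p}`: the image of the uniform distribution on `B_p^n` under
the radial projection `x ↦ x / ‖x‖_p` onto the sphere. For a measurable subset `A` of the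
sphere its value is `|{r x : x ∈ A, 0 ≤ r ≤ 1}| / |B_p^n|`, see `lpCone_apply`. -/
def lpCone (n : ℕ) (p : ℝ) : Measure (EuclideanSpace ℝ (Fin n)) :=
  (lpUniform n p).map fun x => (ellNorm p x)⁻¹ • x

/-- The radial function
`h(r) = Γ(1 + n/p)⁻¹ (1 - r^p)^{-(1 + n/p)} ∫₀^∞ s^{n/p} exp(-r^p s / (1 - r^p)) W(ds)`. -/
def radialDensity (n : ℕ) (p : ℝ) (W : Measure ℝ≥0) (r : ℝ) : ℝ≥0∞ :=
  ENNReal.ofReal (1 / Real.Gamma (1 + n / p) * (1 / (1 - r ^ p) ^ (1 + n / p))) *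
    ∫⁻ s : ℝ≥0, ENNReal.ofReal ((s : ℝ) ^ (n / p) * Real.exp (-(r ^ p * s / (1 - r ^ p)))) ∂W

/-- The measure `P_{n,p,W} = W({0}) C_{n,p} + H U_{n,p}` with `H(x) = h(‖x‖_p)`, for a measure `W`
on `[0, ∞)`. -/
def lpLaw (n : ℕ) (p : ℝ) (W : Measure ℝ≥0) : Measure (EuclideanSpace ℝ (Fin n)) :=
  W {0} • lpCone n p +
    (lpUniform n p).withDensity fun x => radialDensity n p W (ellNorm p x)

theorem measurable_ellNorm {n : ℕ} (p : ℝ) :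
    Measurable (ellNorm p : EuclideanSpace ℝ (Fin n) → ℝ) := by
  unfold ellNorm
  fun_prop

theorem ellNorm_nonneg {n : ℕ} (p : ℝ) (x : EuclideanSpace ℝ (Fin n)) : 0 ≤ ellNorm p x :=
  Real.rpow_nonneg (Finset.sum_nonneg fun _ _ => Real.rpow_nonneg (abs_nonneg _) _) _

theorem ellNorm_smul {n : ℕ} {p : ℝ} (hp : 1 ≤ p) (r : ℝ) (x : EuclideanSpace ℝ (Fin n)) :
    ellNorm p (r • x) = |r| * ellNorm p x := by
  have hp0 : p ≠ 0 := by linarith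
  unfold ellNorm
  simp only [PiLp.smul_apply, smul_eq_mul, abs_mul]
  simp_rw [Real.mul_rpow (abs_nonneg r) (abs_nonneg _)]
  rw [← Finset.mul_sum, Real.mul_rpow (Real.rpow_nonneg (abs_nonneg r) _)
    (Finset.sum_nonneg fun _ _ => Real.rpow_nonneg (abs_nonneg _) _), ← Real.rpow_mul
    (abs_nonneg r), mul_one_div_cancel hp0, Real.rpow_one]

/-- The cone measure of a measurable subset of the sphere is the normalized volume of the cone
over it. -/
theorem lpCone_apply {n : ℕ} (hn : 1 ≤ n) {p : ℝ} (hp : 1 ≤ p)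
    {A : Set (EuclideanSpace ℝ (Fin n))} (hA : MeasurableSet A) (hAS : A ⊆ lpSphere n p) :
    lpCone n p A =
      volume {y | ∃ x ∈ A, ∃ r ∈ Set.Icc (0 : ℝ) 1, y = r • x} / volume (lpBall n p) := by
  have hB : MeasurableSet (lpBall n p) := measurableSet_le (measurable_ellNorm p) measurable_const
  have hf : Measurable fun x : EuclideanSpace ℝ (Fin n) => (ellNorm p x)⁻¹ • x :=
    (measurable_ellNorm p).inv.smul measurable_id
  have : Nonempty (Fin n) := ⟨⟨0, hn⟩⟩
  rw [lpCone, Measure.map_apply hf hA, lpUniform, cond_apply hB, ENNReal.div_eq_inv_mul]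
  congr 1
  have hs : (lpBall n p ∩ (fun x => (ellNorm p x)⁻¹ • x) ⁻¹' A) \ {0} =
      {y | ∃ x ∈ A, ∃ r ∈ Set.Icc (0 : ℝ) 1, y = r • x} \ {0} := by
    ext y
    simp only [Set.mem_sdiff, Set.mem_inter_iff, Set.mem_preimage, Set.mem_ofPred_eq,
      Set.mem_singleton_iff, and_congr_left_iff]
    intro hy
    constructor
    · rintro ⟨hyB, hyA⟩
      refine ⟨_, hyA, ellNorm p y, ⟨ellNorm_nonneg p y, hyB⟩, ?_⟩
      have h1 : ellNorm p ((ellNorm p y)⁻¹ • y) = 1 := hAS hyA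
      have h0 : ellNorm p y ≠ 0 := by
        intro h0
        rw [ellNorm_smul hp, h0] at h1
        simp at h1
      rw [smul_smul, mul_inv_cancel₀ h0, one_smul]
    · rintro ⟨x, hx, r, ⟨hr0, hr1⟩, rfl⟩
      have h1 : ellNorm p x = 1 := hAS hx
      have hr : r ≠ 0 := by
        rintro rfl
        simp at hy
      have h2 : ellNorm p (r • x) = r := by rw [ellNorm_smul hp, h1, mul_one, abs_of_nonneg hr0]
      refine ⟨?_, ?_⟩
      · change ellNorm p (r • x) ≤ 1
        rw [h2]
        exact hr1
      · rw [h2, smul_smul, inv_mul_cancel₀ hr, one_smul]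
        exact hx
  rw [← measure_sdiff_null (measure_singleton (0 : EuclideanSpace ℝ (Fin n))), hs,
    measure_sdiff_null (measure_singleton (0 : EuclideanSpace ℝ (Fin n)))]

/-! ### The Grassmannian and its Haar probability measure -/

/-- The Grassmannian `G_{n,k}` of `k`-dimensional linear subspaces of `ℝⁿ`. -/
def RealGrassmannian (n k : ℕ) : Type :=
  {E : Submodule ℝ (EuclideanSpace ℝ (Fin n)) // Module.finrank ℝ E = k}

/-- The orthogonal projection `P_E` onto the subspace `E`, as a map from `ℝⁿ` to itself. -/
def RealGrassmannian.proj {n k : ℕ} (E : RealGrassmannian n k) :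
    EuclideanSpace ℝ (Fin n) →L[ℝ] EuclideanSpace ℝ (Fin n) :=
  E.1.starProjection

/-- The usual topology of the Grassmannian: a subspace is identified with its orthogonal
projection, that is, `d(E, F) = ‖P_E - P_F‖`. -/
instance (n k : ℕ) : TopologicalSpace (RealGrassmannian n k) :=
  TopologicalSpace.induced RealGrassmannian.proj inferInstance

instance (n k : ℕ) : MeasurableSpace (RealGrassmannian n k) := borel _

instance (n k : ℕ) : BorelSpace (RealGrassmannian n k) := ⟨rfl⟩

instance (n : ℕ) : MeasurableSpace (Matrix.orthogonalGroup (Fin n) ℝ) := borel _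

instance (n : ℕ) : BorelSpace (Matrix.orthogonalGroup (Fin n) ℝ) := ⟨rfl⟩

instance (n : ℕ) : CompactSpace (Matrix.orthogonalGroup (Fin n) ℝ) := by
  refine isCompact_iff_compactSpace.mp (?_ : IsCompact
    (Matrix.orthogonalGroup (Fin n) ℝ : Set (Matrix (Fin n) (Fin n) ℝ)))
  have h : IsCompact (Set.univ.pi fun _ : Fin n => Set.univ.pi fun _ : Fin n =>
      Metric.closedBall (0 : ℝ) 1) :=
    isCompact_univ_pi fun _ => isCompact_univ_pi fun _ => isCompact_closedBall _ _
  refine IsCompact.of_isClosed_subset (X := Matrix (Fin n) (Fin n) ℝ) h isClosed_unitary ?_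
  intro U hU i _ j _
  simpa using entry_norm_bound_of_unitary (𝕜 := ℝ) hU i j

/-- The Haar probability measure on the orthogonal group `O(n)`. -/
def orthogonalHaar (n : ℕ) : Measure (Matrix.orthogonalGroup (Fin n) ℝ) :=
  Measure.haarMeasure ⊤

/-- The linear isometry of `ℝⁿ` given by an orthogonal matrix. -/
def orthogonalIsometry {n : ℕ} (T : Matrix.orthogonalGroup (Fin n) ℝ) :
    EuclideanSpace ℝ (Fin n) ≃ₗᵢ[ℝ] EuclideanSpace ℝ (Fin n) :=
  Unitary.linearIsometryEquiv
    ⟨Matrix.toEuclideanCLM (n := Fin n) (𝕜 := ℝ) T.1, Unitary.map_mem _ T.2⟩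

/-- The image `T E` of a subspace `E` under an orthogonal matrix `T`. -/
def RealGrassmannian.rotate {n k : ℕ} (T : Matrix.orthogonalGroup (Fin n) ℝ)
    (E : RealGrassmannian n k) : RealGrassmannian n k :=
  ⟨E.1.map ((orthogonalIsometry T).toLinearEquiv :
      EuclideanSpace ℝ (Fin n) →ₗ[ℝ] EuclideanSpace ℝ (Fin n)),
    (LinearEquiv.finrank_map_eq _ _).trans E.2⟩

/-- The subspace `E₀` spanned by the first `k` vectors of the canonical basis of `ℝⁿ`. -/
def RealGrassmannian.standard {n k : ℕ} (h : k ≤ n) : RealGrassmannian n k :=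
  ⟨Submodule.span ℝ (Set.range fun i : Fin k => EuclideanSpace.basisFun (Fin n) ℝ (Fin.castLE h i)),
    by
      rw [finrank_span_eq_card, Fintype.card_fin]
      have hb := (EuclideanSpace.basisFun (Fin n) ℝ).toBasis.linearIndependent.comp _
        (Fin.castLE_injective h)
      rw [OrthonormalBasis.coe_toBasis] at hb
      exact hb⟩

/-- The Haar probability measure `ν_{n,k}` on `G_{n,k}`: the image of the Haar probability measure
on `O(n)` under the map `T ↦ T E₀`. -/
def grassmannianHaar {n k : ℕ} (h : k ≤ n) : Measure (RealGrassmannian n k) :=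
  (orthogonalHaar n).map fun T => (RealGrassmannian.standard h).rotate T

/-- The map `T ↦ T E` is continuous. -/
theorem RealGrassmannian.continuous_rotate {n k : ℕ} (E : RealGrassmannian n k) :
    Continuous fun T : Matrix.orthogonalGroup (Fin n) ℝ => E.rotate T := by
  have hL : Continuous fun A : Matrix (Fin n) (Fin n) ℝ =>
      Matrix.toEuclideanCLM (n := Fin n) (𝕜 := ℝ) A :=
    LinearMap.continuous_of_finiteDimensional (E := Matrix (Fin n) (Fin n) ℝ)
      (AlgEquivClass.toAlgEquiv
        (Matrix.toEuclideanCLM (n := Fin n) (𝕜 := ℝ)) |>.toLinearEquiv.toLinearMap)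
  refine continuous_induced_rng.mpr ?_
  have h : (proj ∘ fun T : Matrix.orthogonalGroup (Fin n) ℝ => E.rotate T) =
      fun T => (Matrix.toEuclideanCLM (n := Fin n) (𝕜 := ℝ) T.1).comp
        (E.proj.comp (Matrix.toEuclideanCLM (n := Fin n) (𝕜 := ℝ) (star T).1)) := by
    funext T
    ext1 x
    have h1 : (orthogonalIsometry T).symm x =
        Matrix.toEuclideanCLM (n := Fin n) (𝕜 := ℝ) (star T).1 x :=
      congrArg (fun f : EuclideanSpace ℝ (Fin n) →L[ℝ] EuclideanSpace ℝ (Fin n) => f x)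
        (map_star (Matrix.toEuclideanCLM (n := Fin n) (𝕜 := ℝ)) T.1).symm
    have h2 := Submodule.starProjection_map_apply (orthogonalIsometry T) E.1 x
    rw [h1] at h2
    exact h2
  rw [h]
  exact (hL.comp continuous_subtype_val).clm_comp (continuous_const.clm_comp
    (hL.comp (continuous_subtype_val.comp continuous_star)))

instance (n : ℕ) : IsProbabilityMeasure (orthogonalHaar n) :=
  ⟨Measure.haarMeasure_self (K₀ := ⊤)⟩

instance {n k : ℕ} (h : k ≤ n) : IsProbabilityMeasure (grassmannianHaar h) :=
  Measure.isProbabilityMeasure_map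
    (RealGrassmannian.standard h).continuous_rotate.measurable.aemeasurable

/-! ### The limiting variance -/

/-- The limiting variance `σ²(p, λ)`. -/
def sigmaSq (p lam : ℝ) : ℝ :=
  lam / 4 * (Real.Gamma (1 / p) * Real.Gamma (5 / p) / Real.Gamma (3 / p) ^ 2) -
    lam * (3 / 4 + 1 / p) + 1 / 2

end

noncomputable section

/-! The norm of the projection has an explicit law in terms of independent scalars. By
`map_lpNormalize`, `X` has the law of `y / (‖y‖_p^p + s)^{1/p}`, where `y` has i.i.d. coordinates
with density proportional to `exp (-|t|^p)` and `s` has law `W` independently. By rotation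
invariance (`map_norm_proj_eq`), projecting onto a random subspace has the effect of the random
factor `‖P g‖ / ‖g‖`, with `P` the projection onto the first `k` coordinates and `g` an independent
standard Gaussian vector. Hence `‖P_E X‖` is a product of powers of four sums: `∑ y_i²`, `∑_{i<k}
g_i²`, `∑ g_i²` and `∑ |y_i|^p + s`.

After division of each sum by its mean (with `s` left out of the mean), the normalized quantity is
exactly `√k` times `deltaFun` at the vector of relative fluctuations (`projNorm_eq_deltaFun`).
Multiplied by `√k`, these fluctuations are bounded in probability, so the delta method replaces
`deltaFun - 1` by its derivative at `0`. The variable `s` enters only through a term of size `√k s /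
n`, which tends to `0`; this is why the limit does not depend on `W`.

What remains is a weighted sum of independent centered variables: `√k / n` times the sum of
`fluctuation p (y_i)`, plus the sum of `(g_i² - 1) / 2` with weights `√k (1/k - 1/n)` for `i < k`
and `-√k / n` otherwise. The characteristic functions (`tendsto_charFun_pow`) give the Gaussian
limit. The first sum contributes `lam` times the variance of `fluctuation`, the second contributes
`((1 - lam)² + lam (1 - lam)) / 2 = (1 - lam) / 2`; by `sigmaSq_eq` the total is the stated
variance. -/

/-! ### Characteristic functions of sums of i.i.d. variables. -/

theorem norm_pow_sub_pow_le_of_norm_le_one {a b : ℂ} (ha : ‖a‖ ≤ 1) (hb : ‖b‖ ≤ 1) (n : ℕ) :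
    ‖a ^ n - b ^ n‖ ≤ n * ‖a - b‖ := by
  induction n with
  | zero => simp
  | succ n ih =>
    have h : a ^ (n + 1) - b ^ (n + 1) = a ^ n * (a - b) + (a ^ n - b ^ n) * b := by ring
    rw [h]
    refine (norm_add_le _ _).trans ?_
    rw [norm_mul, norm_mul, norm_pow]
    have h1 : ‖a‖ ^ n * ‖a - b‖ ≤ 1 * ‖a - b‖ :=
      mul_le_mul_of_nonneg_right (pow_le_one₀ (norm_nonneg _) ha) (norm_nonneg _)
    have h2 : ‖a ^ n - b ^ n‖ * ‖b‖ ≤ n * ‖a - b‖ * 1 :=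
      mul_le_mul ih hb (norm_nonneg _) (by positivity)
    push_cast
    linarith

/-- Both functions have the second-order Taylor polynomial `1 - s t² / 2`. The comparison is with
the exponential rather than with this polynomial because the exponential stays in the unit disc and
has explicit powers. -/
theorem charFun_sub_gaussian_isLittleO {μ : Measure ℝ} [IsProbabilityMeasure μ]
    (hm : MemLp id 2 μ) (h0 : ∫ x, x ∂μ = 0) :
    (fun t : ℝ => charFun μ t - Complex.exp (-((∫ x, x ^ 2 ∂μ : ℝ) * t ^ 2 / 2 : ℂ)))
      =o[𝓝 0] fun t : ℝ => t ^ 2 := by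
  set s : ℝ := ∫ x, x ^ 2 ∂μ with hs
  have h1 : (fun t : ℝ => charFun μ t - (1 - (s : ℂ) * t ^ 2 / 2)) =o[𝓝 0] fun t : ℝ => t ^ 2 := by
    have h := taylor_isLittleO_univ (f := charFun μ) (x₀ := 0) (n := 2) (contDiff_charFun hm)
    have h' : ∀ t : ℝ, taylorWithinEval (charFun μ) 2 Set.univ 0 t = 1 - (s : ℂ) * t ^ 2 / 2 := by
      intro t
      have := taylorWithinEval_charFun_two_zero (P := μ) (X := id) aemeasurable_id
        (by rwa [Measure.map_id]) t
      rw [Measure.map_id] at this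
      rw [this]
      simp [h0, hs]
    simp_rw [h', sub_zero] at h
    exact h
  have h2 : (fun t : ℝ => Complex.exp (-((s : ℂ) * t ^ 2 / 2)) - (1 - (s : ℂ) * t ^ 2 / 2))
      =o[𝓝 0] fun t : ℝ => t ^ 2 := by
    have h := (Complex.hasDerivAt_exp 0).isLittleO
    have ht : Tendsto (fun t : ℝ => (-((s : ℂ) * t ^ 2 / 2))) (𝓝 0) (𝓝 0) := by
      have : Continuous fun t : ℝ => (-((s : ℂ) * t ^ 2 / 2)) := by fun_prop
      simpa using this.tendsto 0
    have h3 := h.comp_tendsto ht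
    refine (h3.congr_left ?_).trans_isBigO ?_
    · intro t
      simp
      ring
    · refine Asymptotics.IsBigO.of_bound (|s| / 2) (Eventually.of_forall fun t => ?_)
      simp
      rw [mul_div_right_comm]
  refine (h1.sub h2).congr_left fun t => ?_
  ring

/-- Replacing the characteristic function by the Gaussian one costs at most `N * o(c²) = o(1)`. Only
`c → 0` and the limit of `N c²` are needed: `N` may stay bounded and `v` may be `0`, which covers
the degenerate cases `lam = 0` and `lam = 1`. -/
theorem tendsto_charFun_pow {μ : Measure ℝ} [IsProbabilityMeasure μ]
    (hm : MemLp id 2 μ) (h0 : ∫ x, x ∂μ = 0) {c : ℕ → ℝ} {N : ℕ → ℕ} {v : ℝ}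
    (hc : Tendsto c atTop (𝓝 0)) (hN : Tendsto (fun m => N m * c m ^ 2) atTop (𝓝 v)) :
    Tendsto (fun m => charFun μ (c m) ^ N m) atTop
      (𝓝 (Complex.exp (-((∫ x, x ^ 2 ∂μ : ℝ) * v / 2 : ℂ)))) := by
  set s : ℝ := ∫ x, x ^ 2 ∂μ with hs
  have hs0 : 0 ≤ s := integral_nonneg fun x => sq_nonneg x
  have hg : Tendsto (fun m => Complex.exp (-((s : ℂ) * (c m) ^ 2 / 2)) ^ N m) atTop
      (𝓝 (Complex.exp (-((s : ℂ) * v / 2)))) := by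
    have : (fun m => Complex.exp (-((s : ℂ) * (c m) ^ 2 / 2)) ^ N m) =
        fun m => Complex.exp (-((s : ℂ) * ((N m * c m ^ 2 : ℝ) : ℂ) / 2)) := by
      funext m
      rw [← Complex.exp_nat_mul]
      congr 1
      push_cast
      ring
    rw [this]
    have hcont : Continuous fun x : ℝ => Complex.exp (-((s : ℂ) * (x : ℂ) / 2)) := by fun_prop
    exact (hcont.tendsto v).comp hN
  have hd : Tendsto (fun m => charFun μ (c m) ^ N m -
      Complex.exp (-((s : ℂ) * (c m) ^ 2 / 2)) ^ N m) atTop (𝓝 0) := by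
    have ho := (charFun_sub_gaussian_isLittleO hm h0).comp_tendsto hc
    have ho2 : (fun m => (N m : ℝ) * ‖charFun μ (c m) -
        Complex.exp (-((s : ℂ) * (c m) ^ 2 / 2))‖) =o[atTop] fun m => (N m : ℝ) * c m ^ 2 :=
      (Asymptotics.isBigO_refl (fun m => (N m : ℝ)) atTop).mul_isLittleO ho.norm_left
    have ho3 : Tendsto (fun m => (N m : ℝ) * ‖charFun μ (c m) -
        Complex.exp (-((s : ℂ) * (c m) ^ 2 / 2))‖) atTop (𝓝 0) :=
      (Asymptotics.isLittleO_one_iff ℝ).1 (ho2.trans_isBigO (hN.isBigO_one ℝ))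
    refine squeeze_zero_norm (fun m => ?_) ho3
    refine norm_pow_sub_pow_le_of_norm_le_one (norm_charFun_le_one _) ?_ _
    rw [Complex.norm_exp]
    have : (-((s : ℂ) * (c m : ℂ) ^ 2 / 2)).re = -(s * c m ^ 2 / 2) := by
      rw [← Complex.ofReal_re (-(s * c m ^ 2 / 2))]
      push_cast
      rfl
    rw [this, Real.exp_le_one_iff]
    have := mul_nonneg hs0 (sq_nonneg (c m))
    linarith
  have := hd.add hg
  simpa using this

theorem charFun_map_sum_infinitePi {α : Type*} [MeasurableSpace α] (ν : Measure α)
    [IsProbabilityMeasure ν]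
    {f : α → ℝ} (hf : Measurable f) (c : ℕ → ℝ) (N : ℕ) (t : ℝ) :
    charFun ((Measure.infinitePi fun _ : ℕ => ν).map
      fun ω => ∑ i ∈ Finset.range N, c i * f (ω i)) t =
      ∏ i ∈ Finset.range N, charFun (ν.map f) (c i * t) := by
  have hi : iIndepFun (fun (i : ℕ) (ω : ℕ → α) => c i * f (ω i))
      (Measure.infinitePi fun _ : ℕ => ν) :=
    iIndepFun_infinitePi (X := fun i x => c i * f x) fun i => hf.const_mul _
  rw [(hi.restrict (Finset.range N)).charFun_map_fun_finsetSum_eq_prod fun i _ =>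
    (by fun_prop : Measurable fun ω : ℕ → α => c i * f (ω i)).aemeasurable]
  rw [Finset.prod_apply]
  refine Finset.prod_congr rfl fun i _ => ?_
  rw [charFun_map_mul_comp (X := ℕ → α) (f := fun ω => f (ω i))
    (hf.comp (measurable_pi_apply i)).aemeasurable]
  have : (Measure.infinitePi fun _ : ℕ => ν).map (fun ω : ℕ → α => f (ω i)) = ν.map f := by
    have h := Measure.map_map (μ := Measure.infinitePi fun _ : ℕ => ν) hf (measurable_pi_apply i)
    rw [(measurePreserving_eval_infinitePi (fun _ : ℕ => ν) i).map_eq] at h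
    exact h.symm
  rw [this]

/-! ### Boundedness in probability and the delta method -/

/-- A sequence of random variables is bounded in probability (asymptotically tight). -/
def BoundedInProb {Ω E : Type*} [MeasurableSpace Ω] [Norm E] (P : Measure Ω)
    (X : ℕ → Ω → E) : Prop :=
  ∀ ε : ℝ≥0∞, 0 < ε → ∃ M : ℝ, ∀ᶠ m in atTop, P {ω | M < ‖X m ω‖} ≤ ε

namespace BoundedInProb

variable {Ω E F : Type*} [MeasurableSpace Ω] {P : Measure Ω}
  [SeminormedAddCommGroup E] [SeminormedAddCommGroup F]

theorem prodMk {X : ℕ → Ω → E} {Y : ℕ → Ω → F} (hX : BoundedInProb P X)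
    (hY : BoundedInProb P Y) : BoundedInProb P fun m ω => (X m ω, Y m ω) := by
  intro ε hε
  obtain ⟨M, hM⟩ := hX (ε / 2) (ENNReal.half_pos hε.ne')
  obtain ⟨M', hM'⟩ := hY (ε / 2) (ENNReal.half_pos hε.ne')
  refine ⟨max M M', ?_⟩
  filter_upwards [hM, hM'] with m h1 h2
  calc P {ω | max M M' < ‖(X m ω, Y m ω)‖}
      ≤ P ({ω | M < ‖X m ω‖} ∪ {ω | M' < ‖Y m ω‖}) := by
        refine measure_mono fun ω hω => ?_
        have hω' : max M M' < max ‖X m ω‖ ‖Y m ω‖ := hω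
        rcases lt_max_iff.1 hω' with h | h
        · exact Or.inl ((le_max_left _ _).trans_lt h)
        · exact Or.inr ((le_max_right _ _).trans_lt h)
    _ ≤ ε / 2 + ε / 2 := (measure_union_le _ _).trans (add_le_add h1 h2)
    _ = ε := ENNReal.add_halves ε

theorem add {X Y : ℕ → Ω → E} (hX : BoundedInProb P X)
    (hY : BoundedInProb P Y) : BoundedInProb P fun m ω => X m ω + Y m ω := by
  intro ε hε
  obtain ⟨M, hM⟩ := hX (ε / 2) (ENNReal.half_pos hε.ne')
  obtain ⟨M', hM'⟩ := hY (ε / 2) (ENNReal.half_pos hε.ne')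
  refine ⟨M + M', ?_⟩
  filter_upwards [hM, hM'] with m h1 h2
  calc P {ω | M + M' < ‖X m ω + Y m ω‖}
      ≤ P ({ω | M < ‖X m ω‖} ∪ {ω | M' < ‖Y m ω‖}) := by
        refine measure_mono fun ω hω => ?_
        by_contra hcon
        simp only [Set.mem_union, Set.mem_ofPred_eq, not_or, not_lt] at hcon hω
        have := norm_add_le (X m ω) (Y m ω)
        linarith [hcon.1, hcon.2]
    _ ≤ ε / 2 + ε / 2 := (measure_union_le _ _).trans (add_le_add h1 h2)
    _ = ε := ENNReal.add_halves ε

theorem of_tendsto_zero [IsFiniteMeasure P] {X : ℕ → Ω → ℝ} (hX : ∀ m, Measurable (X m))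
    (h : ∀ ω, Tendsto (fun m => X m ω) atTop (𝓝 0)) : BoundedInProb P X := by
  have h1 : TendstoInMeasure P X atTop (0 : Ω → ℝ) :=
    tendstoInMeasure_of_tendsto_ae (fun m => (hX m).aestronglyMeasurable)
      (Eventually.of_forall h)
  rw [tendstoInMeasure_iff_norm] at h1
  intro ε hε
  refine ⟨1, ?_⟩
  filter_upwards [(h1 1 one_pos).eventually (ge_mem_nhds hε)] with m hm
  refine (measure_mono fun ω hω => ?_).trans hm
  simpa using (show (1 : ℝ) < ‖X m ω‖ from hω).le

theorem of_variance_le [IsFiniteMeasure P] {X : ℕ → Ω → ℝ} (hX : ∀ m, MemLp (X m) 2 P)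
    (h0 : ∀ m, ∫ ω, X m ω ∂P = 0) {C : ℝ} (hC : ∀ m, variance (X m) P ≤ C) :
    BoundedInProb P X := by
  intro ε hε
  have hlim : Tendsto (fun M : ℝ => ENNReal.ofReal (C / M ^ 2)) atTop (𝓝 0) := by
    rw [← ENNReal.ofReal_zero]
    exact ENNReal.tendsto_ofReal (tendsto_const_nhds.div_atTop (tendsto_pow_atTop two_ne_zero))
  obtain ⟨M, hM, hM0⟩ := ((hlim.eventually (ge_mem_nhds hε)).and (eventually_gt_atTop 0)).exists
  refine ⟨M, Eventually.of_forall fun m => ?_⟩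
  calc P {ω | M < ‖X m ω‖} ≤ P {ω | M ≤ |X m ω - ∫ ω, X m ω ∂P|} := by
        refine measure_mono fun ω hω => ?_
        rw [h0 m]
        simpa using (show M < ‖X m ω‖ from hω).le
    _ ≤ ENNReal.ofReal (variance (X m) P / M ^ 2) := meas_ge_le_variance_div_sq (hX m) hM0
    _ ≤ ENNReal.ofReal (C / M ^ 2) := by gcongr; exact hC m
    _ ≤ ε := hM

end BoundedInProb

/-- The delta method: the linearization error of a differentiable function is negligible along a
sequence whose rescaling by `r m → ∞` is bounded in probability. -/
theorem tendstoInMeasure_deltaMethod {Ω E : Type*} [MeasurableSpace Ω] {P : Measure Ω}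
    [NormedAddCommGroup E] [NormedSpace ℝ E] {f : E → ℝ} {f' : E →L[ℝ] ℝ}
    (hf : HasFDerivAt f f' 0) {r : ℕ → ℝ} (hr : Tendsto r atTop atTop) {ξ : ℕ → Ω → E}
    (hξ : BoundedInProb P fun m ω => r m • ξ m ω) :
    TendstoInMeasure P (fun m ω => r m * (f (ξ m ω) - f 0 - f' (ξ m ω))) atTop
      (fun _ => (0 : ℝ)) := by
  rw [tendstoInMeasure_iff_norm]
  intro ε hε
  rw [ENNReal.tendsto_nhds_zero]
  intro δ hδ
  obtain ⟨M₀, hM₀⟩ := hξ δ hδ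
  -- The maximum with `1` only makes `M` positive. The slope `ε / (2 * M)` below is chosen so that
  -- on `r ‖ξ‖ ≤ M` the rescaled error is at most `ε / 2`; the threshold `M / κ` for `r` then forces
  -- `‖ξ‖ < κ`.
  set M := max M₀ 1 with hMdef
  have hM1 : 1 ≤ M := le_max_right _ _
  have hlit := hf.isLittleO
  have hη : 0 < ε / (2 * M) := by positivity
  have hev := hlit.def hη
  rw [Metric.eventually_nhds_iff] at hev
  obtain ⟨κ, hκ, hball⟩ := hev
  filter_upwards [hM₀, hr.eventually_gt_atTop (M / κ), hr.eventually_gt_atTop 0] with m hm hrm hr0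
  refine (measure_mono fun ω hω => ?_).trans hm
  simp only [Set.mem_ofPred_eq, sub_zero] at hω ⊢
  by_contra hcon
  rw [not_lt, norm_smul, Real.norm_of_nonneg hr0.le] at hcon
  have hle : r m * ‖ξ m ω‖ ≤ M := hcon.trans (le_max_left _ _)
  have hsmall : ‖ξ m ω‖ < κ := by
    have h1 : M < r m * κ := by rwa [div_lt_iff₀ hκ] at hrm
    exact lt_of_mul_lt_mul_left (hle.trans_lt h1) hr0.le
  have hb := hball (y := ξ m ω) (by simpa using hsmall)
  simp only [sub_zero] at hb
  rw [norm_mul, Real.norm_of_nonneg hr0.le] at hω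
  have : r m * ‖f (ξ m ω) - f 0 - f' (ξ m ω)‖ ≤ ε / 2 := by
    calc r m * ‖f (ξ m ω) - f 0 - f' (ξ m ω)‖ ≤ r m * (ε / (2 * M) * ‖ξ m ω‖) := by gcongr
      _ = ε / (2 * M) * (r m * ‖ξ m ω‖) := by ring
      _ ≤ ε / (2 * M) * M := by gcongr
      _ = ε / 2 := by field_simp
  linarith

/-! ### Moments of sums of i.i.d. variables. -/

theorem memLp_sum_infinitePi {α : Type*} [MeasurableSpace α] (ν : Measure α)
    [IsProbabilityMeasure ν] {f : α → ℝ} (hm : MemLp f 2 ν) (c : ℝ) (N : ℕ) :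
    MemLp (fun ω : ℕ → α => c * ∑ i ∈ Finset.range N, f (ω i)) 2
      (Measure.infinitePi fun _ : ℕ => ν) := by
  refine MemLp.const_mul (memLp_finsetSum (f := fun i (ω : ℕ → α) => f (ω i)) _ fun i _ => ?_) _
  exact MemLp.comp_measurePreserving hm (measurePreserving_eval_infinitePi (fun _ : ℕ => ν) i)

theorem integral_sum_infinitePi {α : Type*} [MeasurableSpace α] (ν : Measure α)
    [IsProbabilityMeasure ν] {f : α → ℝ} (hm : MemLp f 2 ν) (h0 : ∫ x, f x ∂ν = 0) (c : ℝ)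
    (N : ℕ) :
    ∫ ω : ℕ → α, c * ∑ i ∈ Finset.range N, f (ω i) ∂(Measure.infinitePi fun _ : ℕ => ν) = 0 := by
  have hmp := measurePreserving_eval_infinitePi (fun _ : ℕ => ν)
  rw [integral_const_mul, integral_finsetSum]
  · rw [Finset.sum_eq_zero, mul_zero]
    intro i _
    have h := integral_map (hmp i).measurable.aemeasurable (f := f)
      (by rw [(hmp i).map_eq]; exact hm.1)
    rw [(hmp i).map_eq, h0] at h
    exact h.symm
  · intro i _
    exact (hm.comp_measurePreserving (hmp i)).integrable one_le_two

theorem variance_sum_infinitePi {α : Type*} [MeasurableSpace α] (ν : Measure α)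
    [IsProbabilityMeasure ν] {f : α → ℝ} (hf : Measurable f) (hm : MemLp f 2 ν) (c : ℝ) (N : ℕ) :
    variance (fun ω : ℕ → α => c * ∑ i ∈ Finset.range N, f (ω i))
      (Measure.infinitePi fun _ : ℕ => ν) = c ^ 2 * (N * variance f ν) := by
  have hmp := measurePreserving_eval_infinitePi (fun _ : ℕ => ν)
  have hi : iIndepFun (fun (i : ℕ) (ω : ℕ → α) => f (ω i)) (Measure.infinitePi fun _ : ℕ => ν) :=
    iIndepFun_infinitePi (X := fun _ x => f x) fun i => hf
  rw [variance_const_mul]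
  have h1 : (fun ω : ℕ → α => ∑ i ∈ Finset.range N, f (ω i)) =
      ∑ i ∈ Finset.range N, fun ω : ℕ → α => f (ω i) := by
    ext ω
    simp
  rw [h1, IndepFun.variance_sum]
  · rw [Finset.sum_congr rfl fun i _ => ?_, Finset.sum_const, Finset.card_range, nsmul_eq_mul]
    have h := variance_map (X := f) (μ := Measure.infinitePi fun _ : ℕ => ν) hf.aemeasurable (hmp i).measurable.aemeasurable
    rw [(hmp i).map_eq] at h
    exact h.symm
  · exact fun i _ => hm.comp_measurePreserving (hmp i)
  · exact fun i _ j _ hij => hi.indepFun hij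


/-! ### The `p`-generalized Gaussian distribution -/

/-- The density `t ↦ exp (-|t|^p) / (2 Γ(1 + 1/p))`. -/
def pGaussianPDF (p t : ℝ) : ℝ := Real.exp (-|t| ^ p) / (2 * Real.Gamma (1 + 1 / p))

/-- The distribution on `ℝ` with density `t ↦ exp (-|t|^p) / (2 Γ(1 + 1/p))`. -/
def pGaussian (p : ℝ) : Measure ℝ :=
  volume.withDensity fun t => ENNReal.ofReal (pGaussianPDF p t)

theorem pGaussianPDF_nonneg {p : ℝ} (hp : 1 ≤ p) (t : ℝ) : 0 ≤ pGaussianPDF p t := by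
  have : 0 < Real.Gamma (1 + 1 / p) := Real.Gamma_pos_of_pos (by positivity)
  unfold pGaussianPDF
  positivity

theorem measurable_pGaussianPDF (p : ℝ) : Measurable (pGaussianPDF p) := by
  unfold pGaussianPDF
  fun_prop

theorem integral_pGaussian {p : ℝ} (hp : 1 ≤ p) (f : ℝ → ℝ) :
    ∫ t, f t ∂pGaussian p = ∫ t, pGaussianPDF p t * f t := by
  rw [pGaussian, integral_withDensity_eq_integral_toReal_smul
    (measurable_pGaussianPDF p).ennreal_ofReal (Eventually.of_forall fun _ => ENNReal.ofReal_lt_top)]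
  simp_rw [ENNReal.toReal_ofReal (pGaussianPDF_nonneg hp _), smul_eq_mul]

theorem integral_abs_rpow_pGaussian {p q : ℝ} (hp : 1 ≤ p) (hq : 0 ≤ q) :
    ∫ t, |t| ^ q ∂pGaussian p = Real.Gamma ((q + 1) / p) / Real.Gamma (1 / p) := by
  have hp0 : 0 < p := by linarith
  have hG : 0 < Real.Gamma (1 / p) := Real.Gamma_pos_of_pos (by positivity)
  rw [integral_pGaussian hp]
  have h := integral_comp_abs (f := fun t => Real.exp (-t ^ p) / (2 * Real.Gamma (1 + 1 / p)) * t ^ q)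
  simp only [pGaussianPDF]
  rw [h]
  have h2 : ∀ x : ℝ, Real.exp (-x ^ p) / (2 * Real.Gamma (1 + 1 / p)) * x ^ q =
      (2 * Real.Gamma (1 + 1 / p))⁻¹ * (x ^ q * Real.exp (-x ^ p)) := fun x => by ring
  simp_rw [h2]
  rw [integral_const_mul, integral_rpow_mul_exp_neg_rpow hp0 (by linarith), add_comm 1 (1 / p),
    Real.Gamma_add_one (by positivity)]
  field_simp

theorem integrable_abs_rpow_pGaussian {p q : ℝ} (hp : 1 ≤ p) (hq : 0 ≤ q) :
    Integrable (fun t => |t| ^ q) (pGaussian p) := by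
  -- The Bochner integral of a non-integrable function is `0`, so the positive value found above
  -- already proves integrability.
  refine .of_integral_ne_zero ?_
  rw [integral_abs_rpow_pGaussian hp hq]
  have hp0 : 0 < p := by linarith
  have h1 : 0 < Real.Gamma (1 / p) := Real.Gamma_pos_of_pos (by positivity)
  have h2 : 0 < Real.Gamma ((q + 1) / p) := Real.Gamma_pos_of_pos (by positivity)
  positivity

theorem isProbabilityMeasure_pGaussian {p : ℝ} (hp : 1 ≤ p) :
    IsProbabilityMeasure (pGaussian p) := by
  -- The moment of order `0` is the total mass; its real value being `1` also rules out infinite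
  -- mass.
  have h := integral_abs_rpow_pGaussian hp le_rfl
  have hp0 : 0 < p := by linarith
  have h1 : 0 < Real.Gamma (1 / p) := Real.Gamma_pos_of_pos (by positivity)
  simp only [Real.rpow_zero, integral_const, smul_eq_mul, mul_one, zero_add] at h
  rw [div_self h1.ne'] at h
  rw [measureReal_def] at h
  exact ⟨(ENNReal.toReal_eq_one_iff _).1 h⟩

theorem lintegral_pGaussianPDF {p : ℝ} (hp : 1 ≤ p) :
    ∫⁻ t, ENNReal.ofReal (pGaussianPDF p t) = 1 := by
  have := (isProbabilityMeasure_pGaussian hp).measure_univ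
  rwa [pGaussian, withDensity_apply _ .univ, Measure.restrict_univ] at this

/-- The second moment of the `p`-generalized Gaussian distribution. -/
def secondMoment (p : ℝ) : ℝ := Real.Gamma (3 / p) / Real.Gamma (1 / p)

theorem secondMoment_pos {p : ℝ} (hp : 1 ≤ p) : 0 < secondMoment p := by
  have h1 : 0 < Real.Gamma (1 / p) := Real.Gamma_pos_of_pos (by positivity)
  have h2 : 0 < Real.Gamma (3 / p) := Real.Gamma_pos_of_pos (by positivity)
  exact div_pos h2 h1

/-- The normalized and centered square. -/
def centeredSq (p t : ℝ) : ℝ := t ^ 2 / secondMoment p - 1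

/-- The function `t ↦ p |t|^p`, centered. -/
def centeredPow (p t : ℝ) : ℝ := p * |t| ^ p - 1

/-- The linear part of the fluctuations of the `p`-generalized Gaussian vector. -/
def fluctuation (p t : ℝ) : ℝ := 1 / 2 * centeredSq p t - 1 / p * centeredPow p t

theorem measurable_centeredSq (p : ℝ) : Measurable (centeredSq p) := by
  unfold centeredSq
  fun_prop

theorem measurable_centeredPow (p : ℝ) : Measurable (centeredPow p) := by
  unfold centeredPow
  fun_prop

theorem measurable_fluctuation (p : ℝ) : Measurable (fluctuation p) :=
  ((measurable_centeredSq p).const_mul _).sub ((measurable_centeredPow p).const_mul _)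

theorem memLp_abs_rpow_pGaussian {p q : ℝ} (hp : 1 ≤ p) (hq : 0 ≤ q) :
    MemLp (fun t => |t| ^ q) 2 (pGaussian p) := by
  rw [memLp_two_iff_integrable_sq (by fun_prop)]
  have h := integrable_abs_rpow_pGaussian hp (q := q * 2) (by positivity)
  refine h.congr (Eventually.of_forall fun t => ?_)
  simp only
  rw [Real.rpow_mul (abs_nonneg t), Real.rpow_two]

theorem centeredSq_eq (p t : ℝ) : centeredSq p t = (secondMoment p)⁻¹ * |t| ^ (2 : ℝ) - 1 := by
  rw [centeredSq, Real.rpow_two, sq_abs]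
  ring

theorem memLp_centeredSq {p : ℝ} (hp : 1 ≤ p) : MemLp (centeredSq p) 2 (pGaussian p) := by
  have := isProbabilityMeasure_pGaussian hp
  have h := ((memLp_abs_rpow_pGaussian hp (q := 2) (by norm_num)).const_mul
    (secondMoment p)⁻¹).sub (memLp_const (1 : ℝ))
  exact h.congr_norm (measurable_centeredSq p).aestronglyMeasurable
    (Eventually.of_forall fun t => by rw [centeredSq_eq]; rfl)

theorem memLp_centeredPow {p : ℝ} (hp : 1 ≤ p) : MemLp (centeredPow p) 2 (pGaussian p) := by
  have := isProbabilityMeasure_pGaussian hp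
  exact ((memLp_abs_rpow_pGaussian hp (q := p) (by linarith)).const_mul p).sub
    (memLp_const (1 : ℝ))

theorem memLp_fluctuation {p : ℝ} (hp : 1 ≤ p) : MemLp (fluctuation p) 2 (pGaussian p) :=
  ((memLp_centeredSq hp).const_mul _).sub ((memLp_centeredPow hp).const_mul _)

theorem integral_centeredSq {p : ℝ} (hp : 1 ≤ p) : ∫ t, centeredSq p t ∂pGaussian p = 0 := by
  have := isProbabilityMeasure_pGaussian hp
  simp_rw [centeredSq_eq]
  rw [integral_sub ((integrable_abs_rpow_pGaussian hp (by norm_num)).const_mul _)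
    (integrable_const _), integral_const_mul, integral_abs_rpow_pGaussian hp (by norm_num)]
  have := secondMoment_pos hp
  have h : Real.Gamma ((2 + 1) / p) / Real.Gamma (1 / p) = secondMoment p := by
    norm_num [secondMoment]
  rw [h]
  simp [this.ne']

theorem integral_centeredPow {p : ℝ} (hp : 1 ≤ p) : ∫ t, centeredPow p t ∂pGaussian p = 0 := by
  have := isProbabilityMeasure_pGaussian hp
  have hp0 : 0 < p := by linarith
  have h1 : 0 < Real.Gamma (1 / p) := Real.Gamma_pos_of_pos (by positivity)
  simp_rw [centeredPow]
  rw [integral_sub ((integrable_abs_rpow_pGaussian hp (by linarith)).const_mul _)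
    (integrable_const _), integral_const_mul, integral_abs_rpow_pGaussian hp (by linarith)]
  have h : (p + 1) / p = 1 / p + 1 := by field_simp; ring
  rw [h, Real.Gamma_add_one (by positivity)]
  simp
  field_simp
  ring

theorem integral_fluctuation {p : ℝ} (hp : 1 ≤ p) : ∫ t, fluctuation p t ∂pGaussian p = 0 := by
  have := isProbabilityMeasure_pGaussian hp
  simp_rw [fluctuation]
  rw [integral_sub (((memLp_centeredSq hp).integrable one_le_two).const_mul _)
    (((memLp_centeredPow hp).integrable one_le_two).const_mul _), integral_const_mul,
    integral_const_mul, integral_centeredSq hp, integral_centeredPow hp]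
  simp

theorem integral_fluctuation_sq {p : ℝ} (hp : 1 ≤ p) :
    ∫ t, fluctuation p t ^ 2 ∂pGaussian p =
      1 / 4 * (Real.Gamma (1 / p) * Real.Gamma (5 / p) / Real.Gamma (3 / p) ^ 2) - 1 / 4 - 1 / p := by
  have := isProbabilityMeasure_pGaussian hp
  have hp0 : 0 < p := by linarith
  have h1 : 0 < Real.Gamma (1 / p) := Real.Gamma_pos_of_pos (by positivity)
  have h3 : 0 < Real.Gamma (3 / p) := Real.Gamma_pos_of_pos (by positivity)
  have hs := secondMoment_pos hp
  set s := secondMoment p with hsdef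
  -- The constant term of `fluctuation` is `-k`. The square is expanded into powers of `|t|`,
  -- including `|t| ^ 0`, so that one moment formula evaluates all six terms.
  set k : ℝ := 1 / 2 - 1 / p with hk
  have hexp : ∀ t : ℝ, fluctuation p t ^ 2 =
      1 / 4 * s⁻¹ ^ 2 * |t| ^ (4 : ℝ) + |t| ^ (2 * p) + (-s⁻¹) * |t| ^ (2 + p) +
        (-k * s⁻¹) * |t| ^ (2 : ℝ) + 2 * k * |t| ^ p + k ^ 2 * |t| ^ (0 : ℝ) := by
    intro t
    have e4 : |t| ^ (4 : ℝ) = (|t| ^ (2 : ℝ)) ^ 2 := by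
      rw [← Real.rpow_natCast, ← Real.rpow_mul (abs_nonneg t)]; norm_num
    have e2p : |t| ^ (2 * p) = (|t| ^ p) ^ 2 := by
      rw [mul_comm, Real.rpow_mul (abs_nonneg t), Real.rpow_two]
    have e2 : |t| ^ (2 + p) = |t| ^ (2 : ℝ) * |t| ^ p :=
      Real.rpow_add_of_nonneg (abs_nonneg t) (by norm_num) hp0.le
    rw [e4, e2p, e2, fluctuation, centeredSq_eq, centeredPow, ← hsdef, Real.rpow_zero, hk]
    field_simp
    ring
  have hI : ∀ {q : ℝ}, 0 ≤ q → ∀ c : ℝ, Integrable (fun t => c * |t| ^ q) (pGaussian p) :=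
    fun hq c => (integrable_abs_rpow_pGaussian hp hq).const_mul c
  have hI1 : Integrable (fun t => |t| ^ (2 * p)) (pGaussian p) :=
    integrable_abs_rpow_pGaussian hp (by positivity)
  have i4 := hI (q := 4) (by norm_num) (1 / 4 * s⁻¹ ^ 2)
  have i2p := hI (q := 2 + p) (by positivity) (-s⁻¹)
  have i2 := hI (q := 2) (by norm_num) (-k * s⁻¹)
  have ip := hI (q := p) hp0.le (2 * k)
  have i0 := hI (q := 0) le_rfl (k ^ 2)
  simp_rw [hexp]
  rw [integral_add ((((i4.fun_add hI1).fun_add i2p).fun_add i2).fun_add ip) i0,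
    integral_add (((i4.fun_add hI1).fun_add i2p).fun_add i2) ip,
    integral_add ((i4.fun_add hI1).fun_add i2p) i2,
    integral_add (i4.fun_add hI1) i2p, integral_add i4 hI1]
  simp only [integral_const_mul]
  rw [integral_abs_rpow_pGaussian hp (by norm_num), integral_abs_rpow_pGaussian hp (by positivity),
    integral_abs_rpow_pGaussian hp (by positivity), integral_abs_rpow_pGaussian hp (by norm_num),
    integral_abs_rpow_pGaussian hp hp0.le, integral_abs_rpow_pGaussian hp le_rfl]
  -- The functional equation then leaves only Gamma values at `1 / p`, `3 / p` and `5 / p`.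
  have e1 : (2 * p + 1) / p = (1 / p + 1) + 1 := by field_simp; ring
  have e2 : (2 + p + 1) / p = 3 / p + 1 := by field_simp; ring
  have e3 : (p + 1) / p = 1 / p + 1 := by field_simp; ring
  rw [e1, e2, e3, Real.Gamma_add_one (s := 1 / p + 1) (by positivity),
    Real.Gamma_add_one (s := 1 / p) (by positivity), Real.Gamma_add_one (s := 3 / p) (by positivity)]
  norm_num only [zero_add]
  rw [hsdef, secondMoment, hk]
  field_simp
  ring

/-- The two summands are the contributions of the `p`-Gaussian and of the standard Gaussian
coordinates. This is the form in which the limit appears, and it makes nonnegativity for `lam ∈ [0,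
1]` evident. -/
theorem sigmaSq_eq {p lam : ℝ} (hp : 1 ≤ p) :
    sigmaSq p lam = lam * ∫ t, fluctuation p t ^ 2 ∂pGaussian p + (1 - lam) / 2 := by
  rw [integral_fluctuation_sq hp, sigmaSq]
  ring

theorem sigmaSq_nonneg {p lam : ℝ} (hp : 1 ≤ p) (hlam : lam ∈ Set.Icc (0 : ℝ) 1) :
    0 ≤ sigmaSq p lam := by
  rw [sigmaSq_eq hp]
  have h1 : 0 ≤ ∫ t, fluctuation p t ^ 2 ∂pGaussian p := integral_nonneg fun t => sq_nonneg _
  have h2 := mul_nonneg hlam.1 h1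
  linarith [hlam.2]

/-! ### The centered square of a standard Gaussian variable -/

/-- Half of the centered square. -/
def halfCenteredSq (t : ℝ) : ℝ := 1 / 2 * (t ^ 2 - 1)

theorem measurable_halfCenteredSq : Measurable halfCenteredSq := by
  unfold halfCenteredSq
  fun_prop

theorem integral_abs_rpow_gaussianReal {q : ℝ} (hq : 0 ≤ q) :
    ∫ x : ℝ, |x| ^ q ∂gaussianReal 0 1 =
      2 * (√(2 * Real.pi))⁻¹ * ((1 / 2) ^ (-(q + 1) / 2) * (1 / 2) * Real.Gamma ((q + 1) / 2)) := by
  rw [integral_gaussianReal_eq_integral_smul one_ne_zero]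
  have h := integral_comp_abs
    (f := fun x => (√(2 * Real.pi))⁻¹ * (x ^ q * Real.exp (-(1 / 2) * x ^ (2 : ℝ))))
  have h' : ∫ x in Set.Ioi (0 : ℝ), x ^ q * Real.exp (-(1 / 2) * x ^ (2 : ℝ)) =
      (1 / 2) ^ (-(q + 1) / 2) * (1 / 2) * Real.Gamma ((q + 1) / 2) :=
    integral_rpow_mul_exp_neg_mul_rpow two_pos (by linarith) (by norm_num)
  rw [integral_const_mul (√(2 * Real.pi))⁻¹ (fun x : ℝ => x ^ q * Real.exp _), h',
    ← mul_assoc] at h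
  rw [← h]
  refine integral_congr_ae (Eventually.of_forall fun x => ?_)
  simp [gaussianPDFReal]
  ring_nf

theorem integrable_pow_gaussianReal (n : ℕ) :
    Integrable (fun x : ℝ => x ^ n) (gaussianReal 0 1) := by
  have h : Integrable (fun x : ℝ => |x| ^ (n : ℝ)) (gaussianReal 0 1) := by
    refine .of_integral_ne_zero ?_
    rw [integral_abs_rpow_gaussianReal n.cast_nonneg]
    have : 0 < Real.Gamma (((n : ℝ) + 1) / 2) := Real.Gamma_pos_of_pos (by positivity)
    positivity
  refine h.congr' (by fun_prop) (Eventually.of_forall fun x => ?_)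
  simp

theorem integral_pow_two_gaussianReal : ∫ x : ℝ, x ^ 2 ∂gaussianReal 0 1 = 1 := by
  have h := integral_abs_rpow_gaussianReal (q := 2) (by norm_num)
  have h3 : Real.Gamma ((2 + 1) / 2) = 1 / 2 * √Real.pi := by
    rw [show ((2 : ℝ) + 1) / 2 = 1 / 2 + 1 by norm_num, Real.Gamma_add_one (by norm_num),
      Real.Gamma_one_half_eq]
  have h4 : (1 / 2 : ℝ) ^ (-((2 : ℝ) + 1) / 2) = 2 * √2 := by
    rw [show -((2 : ℝ) + 1) / 2 = -(1 + 1 / 2) by norm_num, one_div, Real.inv_rpow two_pos.le,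
      Real.rpow_neg two_pos.le, inv_inv, Real.rpow_add two_pos, Real.rpow_one, ← one_div,
      Real.sqrt_eq_rpow]
  rw [h3, h4, Real.sqrt_mul two_pos.le] at h
  simp only [Real.rpow_two, sq_abs] at h
  rw [h]
  have := Real.sqrt_pos.2 Real.pi_pos
  have : 0 < √(2 : ℝ) := by positivity
  field_simp

theorem integral_pow_four_gaussianReal : ∫ x : ℝ, x ^ 4 ∂gaussianReal 0 1 = 3 := by
  have h := integral_abs_rpow_gaussianReal (q := 4) (by norm_num)
  have h3 : Real.Gamma ((4 + 1) / 2) = 3 / 4 * √Real.pi := by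
    rw [show ((4 : ℝ) + 1) / 2 = 1 / 2 + 1 + 1 by norm_num, Real.Gamma_add_one (by norm_num),
      Real.Gamma_add_one (by norm_num), Real.Gamma_one_half_eq]
    ring
  have h4 : (1 / 2 : ℝ) ^ (-((4 : ℝ) + 1) / 2) = 4 * √2 := by
    rw [show -((4 : ℝ) + 1) / 2 = -(2 + 1 / 2) by norm_num, one_div, Real.inv_rpow two_pos.le,
      Real.rpow_neg two_pos.le, inv_inv, Real.rpow_add two_pos, Real.rpow_two, ← one_div,
      Real.sqrt_eq_rpow]
    norm_num
  rw [h3, h4, Real.sqrt_mul two_pos.le] at h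
  have h5 : ∀ x : ℝ, |x| ^ (4 : ℝ) = x ^ 4 := fun x => by
    rw [show (4 : ℝ) = ((4 : ℕ) : ℝ) by norm_num, Real.rpow_natCast, Even.pow_abs (by decide)]
  simp_rw [h5] at h
  rw [h]
  have := Real.sqrt_pos.2 Real.pi_pos
  have : 0 < √(2 : ℝ) := by positivity
  field_simp

theorem memLp_halfCenteredSq : MemLp halfCenteredSq 2 (gaussianReal 0 1) := by
  rw [memLp_two_iff_integrable_sq measurable_halfCenteredSq.aestronglyMeasurable]
  have h := (((integrable_pow_gaussianReal 4).const_mul (1 / 4)).sub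
    ((integrable_pow_gaussianReal 2).const_mul (1 / 2))).add (integrable_const (1 / 4))
  refine h.congr (Eventually.of_forall fun t => ?_)
  simp only [halfCenteredSq, Pi.add_apply, Pi.sub_apply]
  ring

theorem integral_halfCenteredSq : ∫ t, halfCenteredSq t ∂gaussianReal 0 1 = 0 := by
  simp_rw [halfCenteredSq]
  rw [integral_const_mul, integral_sub (integrable_pow_gaussianReal 2) (integrable_const _),
    integral_pow_two_gaussianReal]
  simp

theorem integral_halfCenteredSq_sq : ∫ t, halfCenteredSq t ^ 2 ∂gaussianReal 0 1 = 1 / 2 := by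
  have h : ∀ t : ℝ, halfCenteredSq t ^ 2 = 1 / 4 * t ^ 4 - 1 / 2 * t ^ 2 + 1 / 4 := by
    intro t
    simp only [halfCenteredSq]
    ring
  simp_rw [h]
  rw [integral_add (((integrable_pow_gaussianReal 4).const_mul _).sub'
    ((integrable_pow_gaussianReal 2).const_mul _)) (integrable_const _),
    integral_sub ((integrable_pow_gaussianReal 4).const_mul _)
    ((integrable_pow_gaussianReal 2).const_mul _), integral_const_mul, integral_const_mul,
    integral_pow_two_gaussianReal, integral_pow_four_gaussianReal]
  norm_num


/-! ### Polar coordinates for the `ℓ_p`-norm -/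

theorem ellNorm_rpow {n : ℕ} {p : ℝ} (hp : 1 ≤ p) (x : EuclideanSpace ℝ (Fin n)) :
    ellNorm p x ^ p = ∑ i, |x i| ^ p := by
  rw [ellNorm, ← Real.rpow_mul (Finset.sum_nonneg fun _ _ => Real.rpow_nonneg (abs_nonneg _) _),
    one_div_mul_cancel (by linarith), Real.rpow_one]

theorem ellNorm_zero {n : ℕ} {p : ℝ} (hp : 1 ≤ p) :
    ellNorm p (0 : EuclideanSpace ℝ (Fin n)) = 0 := by
  have := ellNorm_smul (n := n) hp 0 0
  simpa using this

theorem ellNorm_eq_zero {n : ℕ} {p : ℝ} (hp : 1 ≤ p) {x : EuclideanSpace ℝ (Fin n)} :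
    ellNorm p x = 0 ↔ x = 0 := by
  refine ⟨fun h => ?_, fun h => h ▸ ellNorm_zero hp⟩
  have hp0 : p ≠ 0 := by linarith
  have h1 := ellNorm_rpow hp x
  rw [h, Real.zero_rpow hp0, eq_comm,
    Finset.sum_eq_zero_iff_of_nonneg fun _ _ => Real.rpow_nonneg (abs_nonneg _) _] at h1
  ext i
  have := h1 i (Finset.mem_univ i)
  rw [Real.rpow_eq_zero (abs_nonneg _) hp0, abs_eq_zero] at this
  simpa using this

theorem measurableSet_lpBall (n : ℕ) (p : ℝ) : MeasurableSet (lpBall n p) :=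
  measurableSet_le (measurable_ellNorm p) measurable_const

theorem measurable_radialProjection (n : ℕ) (p : ℝ) :
    Measurable fun x : EuclideanSpace ℝ (Fin n) => (ellNorm p x)⁻¹ • x :=
  (measurable_ellNorm p).inv.smul measurable_id

theorem volume_lpBall {n : ℕ} (hn : 1 ≤ n) {p : ℝ} (hp : 1 ≤ p) :
    volume (lpBall n p) =
      ENNReal.ofReal ((2 * Real.Gamma (1 + 1 / p)) ^ n / Real.Gamma (1 + n / p)) := by
  have : Nonempty (Fin n) := ⟨⟨0, hn⟩⟩
  rw [← (PiLp.volume_preserving_toLp (Fin n)).measure_preimage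
    (measurableSet_lpBall n p).nullMeasurableSet]
  have h := volume_sum_rpow_le (Fin n) hp 1
  simp only [Fintype.card_fin, ENNReal.ofReal_one, one_pow, one_mul] at h
  rw [add_comm 1 (1 / p), add_comm 1 ((n : ℝ) / p), ← h]
  rfl

theorem volume_lpBall_ne_zero {n : ℕ} (hn : 1 ≤ n) {p : ℝ} (hp : 1 ≤ p) :
    volume (lpBall n p) ≠ 0 := by
  have h1 : 0 < Real.Gamma (1 + 1 / p) := Real.Gamma_pos_of_pos (by positivity)
  have h2 : 0 < Real.Gamma (1 + n / p) := Real.Gamma_pos_of_pos (by positivity)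
  rw [volume_lpBall hn hp]
  exact (ENNReal.ofReal_pos.2 (by positivity)).ne'

theorem volume_lpBall_ne_top {n : ℕ} (hn : 1 ≤ n) {p : ℝ} (hp : 1 ≤ p) :
    volume (lpBall n p) ≠ ∞ := by
  rw [volume_lpBall hn hp]
  exact ENNReal.ofReal_ne_top

theorem isProbabilityMeasure_lpUniform {n : ℕ} (hn : 1 ≤ n) {p : ℝ} (hp : 1 ≤ p) :
    IsProbabilityMeasure (lpUniform n p) :=
  cond_isProbabilityMeasure_of_finite (volume_lpBall_ne_zero hn hp) (volume_lpBall_ne_top hn hp)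

theorem isProbabilityMeasure_lpCone {n : ℕ} (hn : 1 ≤ n) {p : ℝ} (hp : 1 ≤ p) :
    IsProbabilityMeasure (lpCone n p) := by
  have := isProbabilityMeasure_lpUniform hn hp
  exact Measure.isProbabilityMeasure_map (measurable_radialProjection n p).aemeasurable

theorem lpCone_eq_inv_mul {n : ℕ} {p : ℝ} {s : Set (EuclideanSpace ℝ (Fin n))}
    (hs : MeasurableSet s) :
    lpCone n p s = (volume (lpBall n p))⁻¹ *
      volume {x : EuclideanSpace ℝ (Fin n) | (ellNorm p x)⁻¹ • x ∈ s ∧ ellNorm p x ≤ 1} := by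
  rw [lpCone, Measure.map_apply (measurable_radialProjection n p) hs, lpUniform,
    cond_apply (measurableSet_lpBall n p)]
  congr 2
  ext x
  exact and_comm

theorem ae_lpCone_ellNorm {n : ℕ} (hn : 1 ≤ n) {p : ℝ} (hp : 1 ≤ p) :
    ∀ᵐ x ∂lpCone n p, ellNorm p x = 1 := by
  have : Nonempty (Fin n) := ⟨⟨0, hn⟩⟩
  rw [lpCone, ae_map_iff (measurable_radialProjection n p).aemeasurable
    (measurableSet_eq_fun (measurable_ellNorm p) measurable_const)]
  have h0 : ∀ᵐ x ∂lpUniform n p, x ≠ 0 := by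
    rw [lpUniform]
    refine (cond_absolutelyContinuous (μ := volume) (s := lpBall n p)).ae_le ?_
    exact Measure.ae_ne volume 0
  filter_upwards [h0] with x hx
  rw [ellNorm_smul hp, abs_inv, abs_of_nonneg (ellNorm_nonneg p x),
    inv_mul_cancel₀ ((ellNorm_eq_zero hp).not.2 hx)]

/-- The measure `n r^{n-1} dr` on `(0, ∞)`. -/
def radialMeasure (n : ℕ) : Measure ℝ :=
  (volume.restrict (Set.Ioi 0)).withDensity fun r => ENNReal.ofReal (n * r ^ (n - 1))

theorem radialMeasure_Iic {n : ℕ} (hn : 1 ≤ n) (r : ℝ) :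
    radialMeasure n (Set.Iic r) = ENNReal.ofReal r ^ n := by
  rw [radialMeasure, withDensity_apply _ measurableSet_Iic,
    Measure.restrict_restrict measurableSet_Iic, Set.inter_comm, Set.Ioi_inter_Iic]
  rcases le_or_gt r 0 with hr | hr
  · rw [Set.Ioc_eq_empty (not_lt.2 hr), ENNReal.ofReal_of_nonpos hr, zero_pow (by omega)]
    simp
  · have hint : IntervalIntegrable (fun t : ℝ => (n : ℝ) * t ^ (n - 1)) volume 0 r :=
      (by fun_prop : Continuous fun t : ℝ => (n : ℝ) * t ^ (n - 1)).intervalIntegrable _ _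
    rw [← ofReal_integral_eq_lintegral_ofReal hint.1, ← intervalIntegral.integral_of_le hr.le,
      intervalIntegral.integral_const_mul, integral_pow, ← ENNReal.ofReal_pow hr.le]
    · congr 1
      have : n - 1 + 1 = n := by omega
      rw [this]
      have hn' : ((n - 1 : ℕ) : ℝ) + 1 = n := by exact_mod_cast this
      rw [hn', zero_pow (by omega), sub_zero]
      have : (n : ℝ) ≠ 0 := by positivity
      field_simp
    · refine (ae_restrict_mem measurableSet_Ioc).mono fun t ht => ?_
      have := ht.1
      simp only [Pi.zero_apply]
      positivity

/-- For `r > 0` the left set is the dilate by `r` of the set on the right, because the direction is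
invariant under dilation; for `r ≤ 0` at most the origin remains. No measurability of `s` is needed.
-/
theorem volume_cone_le {n : ℕ} (hn : 1 ≤ n) {p : ℝ} (hp : 1 ≤ p)
    (s : Set (EuclideanSpace ℝ (Fin n))) (r : ℝ) :
    volume {x : EuclideanSpace ℝ (Fin n) | (ellNorm p x)⁻¹ • x ∈ s ∧ ellNorm p x ≤ r} =
      ENNReal.ofReal r ^ n *
        volume {x : EuclideanSpace ℝ (Fin n) | (ellNorm p x)⁻¹ • x ∈ s ∧ ellNorm p x ≤ 1} := by
  have : Nonempty (Fin n) := ⟨⟨0, hn⟩⟩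
  rcases le_or_gt r 0 with hr | hr
  · rw [ENNReal.ofReal_of_nonpos hr, zero_pow (by omega), zero_mul]
    refine measure_mono_null (t := {0}) (fun x hx => ?_) (measure_singleton _)
    exact (ellNorm_eq_zero hp).1 (le_antisymm (hx.2.trans hr) (ellNorm_nonneg p x))
  · have h : {x : EuclideanSpace ℝ (Fin n) | (ellNorm p x)⁻¹ • x ∈ s ∧ ellNorm p x ≤ r} =
        (fun x => r⁻¹ • x) ⁻¹'
          {x : EuclideanSpace ℝ (Fin n) | (ellNorm p x)⁻¹ • x ∈ s ∧ ellNorm p x ≤ 1} := by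
      ext x
      simp only [Set.mem_ofPred_eq, Set.mem_preimage]
      rw [ellNorm_smul hp, abs_inv, abs_of_pos hr, smul_smul, mul_inv, inv_inv,
        mul_comm r, mul_assoc, mul_inv_cancel₀ hr.ne', mul_one, inv_mul_le_iff₀ hr, mul_one]
    rw [h, Measure.addHaar_preimage_smul _ (inv_ne_zero hr.ne'), finrank_euclideanSpace,
      Fintype.card_fin, inv_pow, inv_inv, abs_of_pos (by positivity), ENNReal.ofReal_pow hr.le]

/-- By homogeneity both measures agree on the rectangles `s ×ˢ Set.Iic r`. These form a generating
π-system, and the sets `Set.Iic k` of finite measure exhaust the radial factor. -/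
theorem map_volume_polar {n : ℕ} (hn : 1 ≤ n) {p : ℝ} (hp : 1 ≤ p) :
    (volume : Measure (EuclideanSpace ℝ (Fin n))).map
        (fun x => ((ellNorm p x)⁻¹ • x, ellNorm p x)) =
      (lpCone n p).prod (volume (lpBall n p) • radialMeasure n) := by
  have := isProbabilityMeasure_lpCone hn hp
  have hB0 := volume_lpBall_ne_zero hn hp
  have hBt := volume_lpBall_ne_top hn hp
  refine (Measure.prod_eq_generateFrom MeasurableSpace.generateFrom_measurableSet
    ((borel_eq_generateFrom_Iic ℝ).symm.trans BorelSpace.measurable_eq.symm)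
    MeasurableSpace.isPiSystem_measurableSet isPiSystem_Iic
    (lpCone n p).toFiniteSpanningSetsIn
    { set := fun k => Set.Iic (k : ℝ)
      set_mem := fun k => Set.mem_range_self _
      finite := fun k => ?_
      spanning := Set.iUnion_eq_univ_iff.2 fun x => exists_nat_ge x } ?_).symm
  · rw [Measure.smul_apply, radialMeasure_Iic hn, smul_eq_mul]
    exact ENNReal.mul_lt_top hBt.lt_top (ENNReal.pow_lt_top ENNReal.ofReal_lt_top)
  · rintro s hs _ ⟨r, rfl⟩
    have hs : MeasurableSet s := hs
    rw [Measure.map_apply ((measurable_radialProjection n p).prodMk (measurable_ellNorm p))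
      (hs.prod measurableSet_Iic), Measure.smul_apply, radialMeasure_Iic hn, lpCone_eq_inv_mul hs]
    change volume {x : EuclideanSpace ℝ (Fin n) | (ellNorm p x)⁻¹ • x ∈ s ∧ ellNorm p x ≤ r} = _
    rw [volume_cone_le hn hp, smul_eq_mul]
    rw [show ∀ a b c d : ℝ≥0∞, a * b * (c * d) = (a * c) * (d * b) by intros; ring,
      ENNReal.inv_mul_cancel hB0 hBt, one_mul]

theorem lintegral_polar {n : ℕ} (hn : 1 ≤ n) {p : ℝ} (hp : 1 ≤ p)
    {F : EuclideanSpace ℝ (Fin n) → ℝ≥0∞} (hF : Measurable F) :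
    ∫⁻ x, F x = volume (lpBall n p) *
      ∫⁻ r in Set.Ioi (0 : ℝ), ENNReal.ofReal (n * r ^ (n - 1)) *
        ∫⁻ θ, F (r • θ) ∂lpCone n p := by
  have := isProbabilityMeasure_lpCone hn hp
  have hsm : Measurable fun z : EuclideanSpace ℝ (Fin n) × ℝ => F (z.2 • z.1) :=
    hF.comp (measurable_snd.smul measurable_fst)
  have hmeas := (measurable_radialProjection n p).prodMk (measurable_ellNorm (n := n) p)
  have h1 : ∫⁻ x, F x = ∫⁻ z, F (z.2 • z.1)
      ∂(volume : Measure (EuclideanSpace ℝ (Fin n))).map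
        (fun x => ((ellNorm p x)⁻¹ • x, ellNorm p x)) := by
    rw [lintegral_map hsm hmeas]
    refine lintegral_congr fun x => ?_
    by_cases hx : x = 0
    · simp [hx]
    · rw [smul_smul, mul_inv_cancel₀ ((ellNorm_eq_zero hp).not.2 hx), one_smul]
  have hrs : SFinite (radialMeasure n) := by
    unfold radialMeasure
    infer_instance
  rw [h1, map_volume_polar hn hp, lintegral_prod_symm _ hsm.aemeasurable, lintegral_smul_measure,
    smul_eq_mul, radialMeasure, lintegral_withDensity_eq_lintegral_mul _ (by fun_prop)]
  · rfl
  · exact hsm.lintegral_prod_left'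

/-- The radial factor `q` comes out of the inner integral because the cone measure lives on the
sphere. The interval is taken open at `1`, at the cost of a null set, since the later substitution
is singular there. -/
theorem lintegral_lpUniform {n : ℕ} (hn : 1 ≤ n) {p : ℝ} (hp : 1 ≤ p)
    {q : ℝ → ℝ≥0∞} (hq : Measurable q) {f : EuclideanSpace ℝ (Fin n) → ℝ≥0∞} (hf : Measurable f) :
    ∫⁻ x, q (ellNorm p x) * f x ∂lpUniform n p =
      ∫⁻ r in Set.Ioo (0 : ℝ) 1, ENNReal.ofReal (n * r ^ (n - 1)) *
        (q r * ∫⁻ θ, f (r • θ) ∂lpCone n p) := by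
  have hB0 := volume_lpBall_ne_zero hn hp
  have hBt := volume_lpBall_ne_top hn hp
  have hmB := measurableSet_lpBall n p
  have hm : Measurable fun x => q (ellNorm p x) * f x := (hq.comp (measurable_ellNorm p)).mul hf
  rw [lpUniform, ProbabilityTheory.cond, lintegral_smul_measure, ← lintegral_indicator hmB,
    lintegral_polar hn hp (hm.indicator hmB), smul_eq_mul, ← mul_assoc,
    ENNReal.inv_mul_cancel hB0 hBt, one_mul]
  have hset : (∫⁻ r in Set.Ioo (0 : ℝ) 1, ENNReal.ofReal (n * r ^ (n - 1)) *
        (q r * ∫⁻ θ, f (r • θ) ∂lpCone n p)) =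
      ∫⁻ r in Set.Ioi (0 : ℝ), (Set.Iic (1 : ℝ)).indicator (fun r =>
        ENNReal.ofReal (n * r ^ (n - 1)) * (q r * ∫⁻ θ, f (r • θ) ∂lpCone n p)) r := by
    rw [lintegral_indicator measurableSet_Iic, Measure.restrict_restrict measurableSet_Iic,
      Set.inter_comm, Set.Ioi_inter_Iic]
    exact setLIntegral_congr Ioo_ae_eq_Ioc
  rw [hset]
  refine setLIntegral_congr_fun measurableSet_Ioi fun r hr => ?_
  have hr : 0 < r := hr
  have hN : ∀ᵐ θ ∂lpCone n p, ellNorm p (r • θ) = r := by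
    filter_upwards [ae_lpCone_ellNorm hn hp] with θ hθ
    rw [ellNorm_smul hp, hθ, mul_one, abs_of_pos hr]
  by_cases h1 : r ≤ 1
  · rw [Set.indicator_of_mem (show r ∈ Set.Iic (1 : ℝ) from h1)]
    congr 1
    have hfr : Measurable fun θ => f (r • θ) := hf.comp (measurable_const_smul r)
    rw [← lintegral_const_mul _ hfr]
    refine lintegral_congr_ae ?_
    filter_upwards [hN] with θ hθ
    have hmem : r • θ ∈ lpBall n p := (show ellNorm p (r • θ) ≤ 1 by rwa [hθ])
    rw [Set.indicator_of_mem hmem, hθ]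
  · rw [Set.indicator_of_notMem (show r ∉ Set.Iic (1 : ℝ) from h1)]
    rw [mul_eq_zero]
    right
    rw [← lintegral_zero]
    refine lintegral_congr_ae ?_
    filter_upwards [hN] with θ hθ
    have hmem : r • θ ∉ lpBall n p := (show ¬ ellNorm p (r • θ) ≤ 1 by rwa [hθ])
    rw [Set.indicator_of_notMem hmem]

/-! ### The probabilistic representation of `lpLaw` -/

theorem pi_pGaussian {p : ℝ} (hp : 1 ≤ p) (n : ℕ) :
    Measure.pi (fun _ : Fin n => pGaussian p) =
      (volume : Measure (Fin n → ℝ)).withDensity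
        fun y => ENNReal.ofReal (∏ i, pGaussianPDF p (y i)) := by
  have := isProbabilityMeasure_pGaussian hp
  have hint : Integrable (pGaussianPDF p) := by
    refine ⟨(measurable_pGaussianPDF p).aestronglyMeasurable, ?_⟩
    rw [hasFiniteIntegral_iff_ofReal (Eventually.of_forall (pGaussianPDF_nonneg hp)),
      lintegral_pGaussianPDF hp]
    exact ENNReal.one_lt_top
  refine Measure.pi_eq fun s hs => ?_
  rw [withDensity_apply _ (MeasurableSet.univ_pi hs), volume_pi, Measure.restrict_pi_pi,
    ← ofReal_integral_eq_lintegral_ofReal]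
  · rw [integral_fintype_prod_eq_prod, ENNReal.ofReal_prod_of_nonneg]
    · refine Finset.prod_congr rfl fun i _ => ?_
      rw [pGaussian, withDensity_apply _ (hs i), ofReal_integral_eq_lintegral_ofReal hint.integrableOn]
      exact Eventually.of_forall (pGaussianPDF_nonneg hp)
    · exact fun i _ => integral_nonneg (pGaussianPDF_nonneg hp)
  · exact Integrable.fintype_prod fun i => hint.integrableOn
  · exact Eventually.of_forall fun y => Finset.prod_nonneg fun i _ => pGaussianPDF_nonneg hp _

/-- The product of the one-dimensional densities depends on the vector only through its `ℓ_p`-norm,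
which is what makes polar coordinates separate radius and direction. -/
theorem map_toLp_pi_pGaussian {p : ℝ} (hp : 1 ≤ p) (n : ℕ) :
    (Measure.pi fun _ : Fin n => pGaussian p).map (WithLp.toLp 2) =
      (volume : Measure (EuclideanSpace ℝ (Fin n))).withDensity fun x =>
        ENNReal.ofReal (Real.exp (-ellNorm p x ^ p) / (2 * Real.Gamma (1 + 1 / p)) ^ n) := by
  have hmp := PiLp.volume_preserving_toLp (Fin n)
  have hd : ∀ y : Fin n → ℝ, ∏ i, pGaussianPDF p (y i) =
      Real.exp (-ellNorm p (WithLp.toLp 2 y) ^ p) / (2 * Real.Gamma (1 + 1 / p)) ^ n := by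
    intro y
    simp_rw [pGaussianPDF]
    rw [Finset.prod_div_distrib, ← Real.exp_sum, ellNorm_rpow hp]
    simp
  have hm : Measurable fun x : EuclideanSpace ℝ (Fin n) =>
      ENNReal.ofReal (Real.exp (-ellNorm p x ^ p) / (2 * Real.Gamma (1 + 1 / p)) ^ n) := by
    have := measurable_ellNorm (n := n) p
    fun_prop
  ext s hs
  rw [Measure.map_apply hmp.measurable hs, pi_pGaussian hp,
    withDensity_apply _ (hmp.measurable hs), withDensity_apply _ hs,
    ← hmp.setLIntegral_comp_preimage hs hm]
  simp_rw [hd]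


/-- The conditional radial density given the value `s` of the mixing variable. -/
def conditionalDensity (n : ℕ) (p s r : ℝ) : ℝ≥0∞ :=
  ENNReal.ofReal (1 / Real.Gamma (1 + n / p) * (1 / (1 - r ^ p) ^ (1 + n / p))) *
    ENNReal.ofReal (s ^ (n / p) * Real.exp (-(r ^ p * s / (1 - r ^ p))))

theorem measurable_conditionalDensity (n : ℕ) (p s : ℝ) :
    Measurable (conditionalDensity n p s) := by
  unfold conditionalDensity
  fun_prop

/-- The substitution is the inverse of `ρ ↦ ρ / (ρ^p + s)^{1/p}`, found by solving `r^p = ρ^p / (ρ^p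
+ s)` for `ρ`. The left inverse in the last clause also supplies injectivity. -/
theorem image_radial_change {p : ℝ} (hp : 1 ≤ p) {s : ℝ} (hs : 0 < s) :
    (fun r : ℝ => s ^ (1 / p) * (r * (1 - r ^ p) ^ (-(1 / p)))) '' Set.Ioo 0 1 = Set.Ioi 0 ∧
    ∀ r ∈ Set.Ioo (0 : ℝ) 1,
      (s ^ (1 / p) * (r * (1 - r ^ p) ^ (-(1 / p)))) ^ p = r ^ p * s / (1 - r ^ p) ∧
      (((s ^ (1 / p) * (r * (1 - r ^ p) ^ (-(1 / p)))) ^ p + s) ^ (1 / p))⁻¹ *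
        (s ^ (1 / p) * (r * (1 - r ^ p) ^ (-(1 / p)))) = r := by
  have hp0 : 0 < p := by linarith
  have hpow : ∀ r ∈ Set.Ioo (0 : ℝ) 1, 0 < 1 - r ^ p := fun r hr => by
    have := Real.rpow_lt_one hr.1.le hr.2 hp0
    linarith
  have key : ∀ r ∈ Set.Ioo (0 : ℝ) 1,
      (s ^ (1 / p) * (r * (1 - r ^ p) ^ (-(1 / p)))) ^ p = r ^ p * s / (1 - r ^ p) := by
    intro r hr
    have h1 := hpow r hr
    rw [Real.mul_rpow (by positivity) (mul_nonneg hr.1.le (by positivity)),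
      Real.mul_rpow hr.1.le (by positivity), ← Real.rpow_mul hs.le, ← Real.rpow_mul h1.le,
      one_div_mul_cancel hp0.ne', Real.rpow_one, neg_mul, one_div_mul_cancel hp0.ne',
      Real.rpow_neg_one]
    ring
  refine ⟨?_, fun r hr => ⟨key r hr, ?_⟩⟩
  · ext ρ
    constructor
    · rintro ⟨r, hr, rfl⟩
      have h1 := hpow r hr
      have := hr.1
      simp only [Set.mem_Ioi]
      positivity
    · intro hρ
      have hρ : 0 < ρ := hρ
      have hρp : 0 < ρ ^ p := by positivity
      refine ⟨(ρ ^ p / (ρ ^ p + s)) ^ (1 / p), ⟨by positivity, ?_⟩, ?_⟩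
      · refine Real.rpow_lt_one (by positivity) ?_ (by positivity)
        rw [div_lt_one (by positivity)]
        linarith
      · simp only
        rw [← Real.rpow_mul (by positivity), one_div_mul_cancel hp0.ne', Real.rpow_one]
        have : 1 - ρ ^ p / (ρ ^ p + s) = s / (ρ ^ p + s) := by
          field_simp
          ring
        rw [this, Real.rpow_neg (by positivity), ← Real.inv_rpow (by positivity),
          ← Real.mul_rpow (by positivity) (by positivity),
          ← Real.mul_rpow (by positivity) (by positivity)]
        have : s * (ρ ^ p / (ρ ^ p + s) * (s / (ρ ^ p + s))⁻¹) = ρ ^ p := by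
          field_simp
        rw [this, ← Real.rpow_mul hρ.le, mul_one_div_cancel hp0.ne', Real.rpow_one]
  · have h1 := hpow r hr
    have h2 : r ^ p * s / (1 - r ^ p) + s = s * (1 - r ^ p)⁻¹ := by
      field_simp
      ring
    rw [key r hr, h2, Real.mul_rpow hs.le (by positivity), Real.rpow_neg h1.le,
      Real.inv_rpow h1.le]
    have h3 : 0 < (1 - r ^ p) ^ (1 / p) := by positivity
    have h4 : 0 < s ^ (1 / p) := by positivity
    field_simp

/-- The product rule gives `(1 - r^p)^{-1/p-1}` times `(1 - r^p) + r^p = 1`. -/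
theorem hasDerivAt_radial_change {p : ℝ} (hp : 1 ≤ p) (s : ℝ) {r : ℝ} (hr : r ∈ Set.Ioo (0 : ℝ) 1) :
    HasDerivAt (fun r : ℝ => s ^ (1 / p) * (r * (1 - r ^ p) ^ (-(1 / p))))
      (s ^ (1 / p) * (1 - r ^ p) ^ (-(1 / p) - 1)) r := by
  have hp0 : 0 < p := by linarith
  have h1 : 0 < 1 - r ^ p := by
    have := Real.rpow_lt_one hr.1.le hr.2 hp0
    linarith
  have hd : HasDerivAt (fun r : ℝ => 1 - r ^ p) (-(p * r ^ (p - 1))) r :=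
    (Real.hasDerivAt_rpow_const (Or.inl hr.1.ne')).const_sub 1
  have h := ((hasDerivAt_id r).mul (hd.rpow_const (p := -(1 / p)) (Or.inl h1.ne'))).const_mul
    (s ^ (1 / p))
  refine h.congr_deriv ?_
  congr 1
  have e1 : (1 - r ^ p) ^ (-(1 / p)) = (1 - r ^ p) ^ (-(1 / p) - 1) * (1 - r ^ p) := by
    rw [← Real.rpow_add_one h1.ne']
    congr 1
    ring
  have e2 : r * r ^ (p - 1) = r ^ p := by
    rw [mul_comm, ← Real.rpow_add_one hr.1.ne']
    congr 1
    ring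
  simp only [id]
  rw [e1, ← e2]
  field_simp
  ring

/-- This explains the form of `conditionalDensity`: `exp (-ρ^p)` becomes its exponential factor,
while `ρ^{n-1} dρ` becomes `s^{n/p} (1 - r^p)^{-(1 + n/p)} r^{n-1} dr`. -/
theorem lintegral_radial_change {n : ℕ} (hn : 1 ≤ n) {p : ℝ} (hp : 1 ≤ p) {s : ℝ} (hs : 0 < s)
    (ψ : ℝ → ℝ≥0∞) :
    ∫⁻ ρ in Set.Ioi (0 : ℝ), ENNReal.ofReal (n * ρ ^ (n - 1)) *
        (ENNReal.ofReal (Real.exp (-ρ ^ p) / Real.Gamma (1 + n / p)) *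
          ψ (((ρ ^ p + s) ^ (1 / p))⁻¹ * ρ)) =
      ∫⁻ r in Set.Ioo (0 : ℝ) 1, ENNReal.ofReal (n * r ^ (n - 1)) *
        (conditionalDensity n p s r * ψ r) := by
  have hp0 : 0 < p := by linarith
  have hG : 0 < Real.Gamma (1 + n / p) := Real.Gamma_pos_of_pos (by positivity)
  obtain ⟨him, hval⟩ := image_radial_change hp hs
  have hinj : Set.InjOn (fun r : ℝ => s ^ (1 / p) * (r * (1 - r ^ p) ^ (-(1 / p))))
      (Set.Ioo 0 1) := by
    intro a ha b hb hab
    have hab : s ^ (1 / p) * (a * (1 - a ^ p) ^ (-(1 / p))) =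
      s ^ (1 / p) * (b * (1 - b ^ p) ^ (-(1 / p))) := hab
    rw [← (hval a ha).2, ← (hval b hb).2, hab]
  rw [← him, lintegral_image_eq_lintegral_abs_deriv_mul measurableSet_Ioo
    (fun r hr => (hasDerivAt_radial_change hp s hr).hasDerivWithinAt) hinj]
  refine setLIntegral_congr_fun measurableSet_Ioo fun r hr => ?_
  have h1 : 0 < 1 - r ^ p := by
    have := Real.rpow_lt_one hr.1.le hr.2 hp0
    linarith
  have hr0 := hr.1
  rw [(hval r hr).2, (hval r hr).1, conditionalDensity, ← mul_assoc, ← mul_assoc,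
    ← mul_assoc (ENNReal.ofReal (n * r ^ (n - 1))),
    ← ENNReal.ofReal_mul (by positivity), ← ENNReal.ofReal_mul (by positivity),
    ← ENNReal.ofReal_mul (by positivity), ← ENNReal.ofReal_mul (by positivity)]
  congr 2
  rw [abs_of_pos (by positivity)]
  have e1 : (s ^ (1 / p)) ^ (n - 1) * s ^ (1 / p) = s ^ (n / p) := by
    rw [← pow_succ, Nat.sub_add_cancel hn, ← Real.rpow_natCast, ← Real.rpow_mul hs.le]
    congr 1
    ring
  have e2 : ((1 - r ^ p) ^ (-(1 / p))) ^ (n - 1) * (1 - r ^ p) ^ (-(1 / p) - 1) =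
      1 / (1 - r ^ p) ^ (1 + n / p) := by
    rw [one_div ((1 - r ^ p) ^ (1 + n / p)), ← Real.rpow_neg h1.le, ← Real.rpow_natCast,
      ← Real.rpow_mul h1.le, ← Real.rpow_add h1]
    congr 1
    rw [Nat.cast_sub hn]
    push_cast
    ring
  rw [mul_pow, mul_pow, ← e1, ← e2]
  ring

/-- The random vector `y / (‖y‖_p^p + s)^{1/p}`. -/
def lpNormalize {n : ℕ} (p : ℝ) (x : EuclideanSpace ℝ (Fin n)) (s : ℝ) :
    EuclideanSpace ℝ (Fin n) :=
  ((ellNorm p x ^ p + s) ^ (1 / p))⁻¹ • x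

theorem measurable_lpNormalize {n : ℕ} (p : ℝ) :
    Measurable fun z : EuclideanSpace ℝ (Fin n) × ℝ≥0 => lpNormalize p z.1 z.2 := by
  have := measurable_ellNorm (n := n) p
  unfold lpNormalize
  fun_prop

/-- The volume of the ball cancels the normalizing constant `(2 Γ(1 + 1/p))^n` of the density and
leaves `1 / Γ(1 + n/p)`. -/
theorem lintegral_gaussian_polar {n : ℕ} (hn : 1 ≤ n) {p : ℝ} (hp : 1 ≤ p)
    {F : EuclideanSpace ℝ (Fin n) → ℝ≥0∞} (hF : Measurable F) :
    ∫⁻ x, F x ∂(Measure.pi fun _ : Fin n => pGaussian p).map (WithLp.toLp 2) =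
      ∫⁻ ρ in Set.Ioi (0 : ℝ), ENNReal.ofReal (n * ρ ^ (n - 1)) *
        (ENNReal.ofReal (Real.exp (-ρ ^ p) / Real.Gamma (1 + n / p)) *
          ∫⁻ θ, F (ρ • θ) ∂lpCone n p) := by
  have hG : 0 < Real.Gamma (1 + n / p) := Real.Gamma_pos_of_pos (by positivity)
  have hG1 : 0 < Real.Gamma (1 + 1 / p) := Real.Gamma_pos_of_pos (by positivity)
  have hm : Measurable fun x : EuclideanSpace ℝ (Fin n) =>
      ENNReal.ofReal (Real.exp (-ellNorm p x ^ p) / (2 * Real.Gamma (1 + 1 / p)) ^ n) := by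
    have := measurable_ellNorm (n := n) p
    fun_prop
  rw [map_toLp_pi_pGaussian hp, lintegral_withDensity_eq_lintegral_mul _ hm hF,
    lintegral_polar hn hp (hm.mul hF), ← lintegral_const_mul' _ _ (volume_lpBall_ne_top hn hp)]
  refine setLIntegral_congr_fun measurableSet_Ioi fun ρ hρ => ?_
  have hρ : 0 < ρ := hρ
  have h : ∫⁻ θ, ((fun x : EuclideanSpace ℝ (Fin n) =>
      ENNReal.ofReal (Real.exp (-ellNorm p x ^ p) / (2 * Real.Gamma (1 + 1 / p)) ^ n)) * F)
        (ρ • θ) ∂lpCone n p =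
      ENNReal.ofReal (Real.exp (-ρ ^ p) / (2 * Real.Gamma (1 + 1 / p)) ^ n) *
        ∫⁻ θ, F (ρ • θ) ∂lpCone n p := by
    rw [← lintegral_const_mul' _ _ ENNReal.ofReal_ne_top]
    refine lintegral_congr_ae ?_
    filter_upwards [ae_lpCone_ellNorm hn hp] with θ hθ
    simp only [Pi.mul_apply]
    rw [ellNorm_smul hp, hθ, mul_one, abs_of_pos hρ]
  rw [h, volume_lpBall hn hp, mul_left_comm, ← mul_assoc (ENNReal.ofReal (_ / _)),
    ← ENNReal.ofReal_mul (by positivity)]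
  congr 3
  field_simp

theorem isProbabilityMeasure_map_toLp_pi_pGaussian {p : ℝ} (hp : 1 ≤ p) (n : ℕ) :
    IsProbabilityMeasure ((Measure.pi fun _ : Fin n => pGaussian p).map (WithLp.toLp 2)) := by
  have := isProbabilityMeasure_pGaussian hp
  exact Measure.isProbabilityMeasure_map
    (PiLp.volume_preserving_toLp (Fin n)).measurable.aemeasurable

theorem lintegral_lpCone_lpNormalize {n : ℕ} (hn : 1 ≤ n) {p : ℝ} (hp : 1 ≤ p) (s : ℝ)
    (f : EuclideanSpace ℝ (Fin n) → ℝ≥0∞) {ρ : ℝ} (hρ : 0 < ρ) :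
    ∫⁻ θ, f (lpNormalize p (ρ • θ) s) ∂lpCone n p =
      ∫⁻ θ, f ((((ρ ^ p + s) ^ (1 / p))⁻¹ * ρ) • θ) ∂lpCone n p := by
  refine lintegral_congr_ae ?_
  filter_upwards [ae_lpCone_ellNorm hn hp] with θ hθ
  rw [lpNormalize, ellNorm_smul hp, hθ, mul_one, abs_of_pos hρ, smul_smul]

/-- For `s = 0` the normalization forgets the radius, so only the direction, distributed by the cone
measure, is left. -/
theorem lintegral_lpNormalize_zero {n : ℕ} (hn : 1 ≤ n) {p : ℝ} (hp : 1 ≤ p)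
    {f : EuclideanSpace ℝ (Fin n) → ℝ≥0∞} (hf : Measurable f) :
    ∫⁻ x, f (lpNormalize p x 0) ∂(Measure.pi fun _ : Fin n => pGaussian p).map (WithLp.toLp 2) =
      ∫⁻ x, f x ∂lpCone n p := by
  have hp0 : 0 < p := by linarith
  have hcone := isProbabilityMeasure_lpCone hn hp
  have hmeas : Measurable fun x : EuclideanSpace ℝ (Fin n) => f (lpNormalize p x 0) := by
    have := measurable_ellNorm (n := n) p
    unfold lpNormalize
    fun_prop
  rw [lintegral_gaussian_polar hn hp hmeas]
  -- The polar formula for the constant `1` shows that the radial integral equals `1`, without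
  -- computing it.
  have h1 := lintegral_gaussian_polar hn hp (F := fun _ => 1) measurable_const
  have hpi := isProbabilityMeasure_map_toLp_pi_pGaussian hp n
  rw [lintegral_one, measure_univ] at h1
  have h2 : ∀ ρ ∈ Set.Ioi (0 : ℝ), ENNReal.ofReal (n * ρ ^ (n - 1)) *
      (ENNReal.ofReal (Real.exp (-ρ ^ p) / Real.Gamma (1 + n / p)) *
        ∫⁻ θ, f (lpNormalize p (ρ • θ) 0) ∂lpCone n p) =
      (ENNReal.ofReal (n * ρ ^ (n - 1)) *
      (ENNReal.ofReal (Real.exp (-ρ ^ p) / Real.Gamma (1 + n / p)) *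
        ∫⁻ _, 1 ∂lpCone n p)) * ∫⁻ θ, f θ ∂lpCone n p := by
    intro ρ hρ
    have hρ : 0 < ρ := hρ
    rw [lintegral_lpCone_lpNormalize hn hp 0 f hρ, add_zero, ← Real.rpow_mul hρ.le,
      mul_one_div_cancel hp0.ne', Real.rpow_one, inv_mul_cancel₀ hρ.ne', lintegral_one,
      measure_univ, mul_one]
    simp_rw [one_smul]
    ring
  rw [setLIntegral_congr_fun measurableSet_Ioi h2, lintegral_mul_const, ← h1, one_mul]
  simp only [lintegral_one, measure_univ]
  fun_prop

theorem lintegral_lpNormalize_of_pos {n : ℕ} (hn : 1 ≤ n) {p : ℝ} (hp : 1 ≤ p) {s : ℝ} (hs : 0 < s)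
    {f : EuclideanSpace ℝ (Fin n) → ℝ≥0∞} (hf : Measurable f) :
    ∫⁻ x, f (lpNormalize p x s) ∂(Measure.pi fun _ : Fin n => pGaussian p).map (WithLp.toLp 2) =
      ∫⁻ x, conditionalDensity n p s (ellNorm p x) * f x ∂lpUniform n p := by
  have hmeas : Measurable fun x : EuclideanSpace ℝ (Fin n) => f (lpNormalize p x s) := by
    have := measurable_ellNorm (n := n) p
    unfold lpNormalize
    fun_prop
  rw [lintegral_gaussian_polar hn hp hmeas,
    lintegral_lpUniform hn hp (measurable_conditionalDensity n p s) hf,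
    ← lintegral_radial_change hn hp hs (fun r => ∫⁻ θ, f (r • θ) ∂lpCone n p)]
  refine setLIntegral_congr_fun measurableSet_Ioi fun ρ hρ => ?_
  rw [lintegral_lpCone_lpNormalize hn hp s f hρ]

/-- Since `n ≥ 1`, the factor `0 ^ (n / p)` vanishes. Hence an atom of `W` at `0` produces only the
cone part of `lpLaw` and nothing in the density part. -/
theorem conditionalDensity_zero {n : ℕ} (hn : 1 ≤ n) {p : ℝ} (hp : 1 ≤ p) (r : ℝ) :
    conditionalDensity n p 0 r = 0 := by
  have hp0 : 0 < p := by linarith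
  have : (n : ℝ) / p ≠ 0 := by positivity
  rw [conditionalDensity, Real.zero_rpow this, zero_mul, ENNReal.ofReal_zero, mul_zero]

theorem lintegral_lpNormalize {n : ℕ} (hn : 1 ≤ n) {p : ℝ} (hp : 1 ≤ p) (s : ℝ≥0)
    {f : EuclideanSpace ℝ (Fin n) → ℝ≥0∞} (hf : Measurable f) :
    ∫⁻ x, f (lpNormalize p x s) ∂(Measure.pi fun _ : Fin n => pGaussian p).map (WithLp.toLp 2) =
      ({0} : Set ℝ≥0).indicator (fun _ => ∫⁻ x, f x ∂lpCone n p) s +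
        ∫⁻ x, conditionalDensity n p s (ellNorm p x) * f x ∂lpUniform n p := by
  rcases eq_or_ne s 0 with rfl | hs
  · rw [Set.indicator_of_mem (Set.mem_singleton _), NNReal.coe_zero,
      lintegral_lpNormalize_zero hn hp hf]
    simp_rw [conditionalDensity_zero hn hp, zero_mul]
    rw [lintegral_zero, add_zero]
  · rw [Set.indicator_of_notMem (by simpa using hs), zero_add,
      lintegral_lpNormalize_of_pos hn hp (NNReal.coe_pos.2 (pos_iff_ne_zero.2 hs)) hf]

theorem measurable_conditionalDensity_ellNorm (n : ℕ) (p : ℝ) :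
    Measurable fun z : ℝ≥0 × EuclideanSpace ℝ (Fin n) =>
      conditionalDensity n p z.1 (ellNorm p z.2) := by
  have h : Measurable fun z : ℝ × ℝ => conditionalDensity n p z.1 z.2 := by
    unfold conditionalDensity
    fun_prop
  have h' : Measurable fun z : ℝ≥0 × EuclideanSpace ℝ (Fin n) => ((z.1 : ℝ), ellNorm p z.2) :=
    measurable_fst.coe_nnreal_real.prodMk ((measurable_ellNorm p).comp measurable_snd)
  have h'' := h.comp h'
  exact h''

theorem radialDensity_eq_lintegral (n : ℕ) (p : ℝ) (W : Measure ℝ≥0) (r : ℝ) :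
    radialDensity n p W r = ∫⁻ s, conditionalDensity n p s r ∂W := by
  simp only [radialDensity, conditionalDensity]
  rw [lintegral_const_mul' _ _ ENNReal.ofReal_ne_top]

theorem measurable_radialDensity_ellNorm (n : ℕ) (p : ℝ) (W : Measure ℝ≥0) [SFinite W] :
    Measurable fun x : EuclideanSpace ℝ (Fin n) => radialDensity n p W (ellNorm p x) := by
  simp_rw [radialDensity_eq_lintegral]
  exact (measurable_conditionalDensity_ellNorm n p).lintegral_prod_left'

/-- If `y` is a `p`-generalized Gaussian vector and `s` is independent of `y` with law `W`, then
`y / (‖y‖_p^p + s)^{1/p}` has law `P_{n,p,W}`. -/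
theorem map_lpNormalize {n : ℕ} (hn : 1 ≤ n) {p : ℝ} (hp : 1 ≤ p) (W : Measure ℝ≥0)
    [IsProbabilityMeasure W] :
    (((Measure.pi fun _ : Fin n => pGaussian p).map (WithLp.toLp 2)).prod W).map
      (fun z : EuclideanSpace ℝ (Fin n) × ℝ≥0 => lpNormalize p z.1 z.2) = lpLaw n p W := by
  have hU := isProbabilityMeasure_lpUniform hn hp
  have hpi := isProbabilityMeasure_map_toLp_pi_pGaussian hp n
  refine Measure.ext_of_lintegral _ fun f hf => ?_
  have hmc := measurable_conditionalDensity_ellNorm n p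
  have hfm : Measurable fun z : EuclideanSpace ℝ (Fin n) × ℝ≥0 => f (lpNormalize p z.1 z.2) :=
    hf.comp (measurable_lpNormalize p)
  rw [lintegral_map hf (measurable_lpNormalize p), lintegral_prod_symm _ hfm.aemeasurable]
  simp_rw [lintegral_lpNormalize hn hp _ hf]
  rw [lintegral_add_left (measurable_const.indicator (measurableSet_singleton _)),
    lintegral_indicator (measurableSet_singleton _), setLIntegral_const, lpLaw,
    lintegral_add_measure, lintegral_smul_measure,
    lintegral_withDensity_eq_lintegral_mul _ (measurable_radialDensity_ellNorm n p W) hf,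
    smul_eq_mul, mul_comm (W {0})]
  congr 1
  have hswap : AEMeasurable (Function.uncurry fun (s : ℝ≥0) (x : EuclideanSpace ℝ (Fin n)) =>
      conditionalDensity n p s (ellNorm p x) * f x) (W.prod (lpUniform n p)) := by
    have h := (hmc.mul (hf.comp measurable_snd)).aemeasurable (μ := W.prod (lpUniform n p))
    exact h
  -- By Tonelli, averaging `conditionalDensity` over `s` first yields `radialDensity`.
  rw [lintegral_lintegral_swap hswap]
  refine lintegral_congr fun x => ?_
  have hmx : Measurable fun s : ℝ≥0 => conditionalDensity n p s (ellNorm p x) := by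
    have h := hmc.comp (measurable_prodMk_right (y := x))
    exact h
  rw [Pi.mul_apply, lintegral_mul_const _ hmx, radialDensity_eq_lintegral]


/-! ### Random projections and Gaussian vectors -/

theorem continuous_toEuclideanCLM (n : ℕ) :
    Continuous fun A : Matrix (Fin n) (Fin n) ℝ => Matrix.toEuclideanCLM (n := Fin n) (𝕜 := ℝ) A :=
  LinearMap.continuous_of_finiteDimensional (E := Matrix (Fin n) (Fin n) ℝ)
    (AlgEquivClass.toAlgEquiv
      (Matrix.toEuclideanCLM (n := Fin n) (𝕜 := ℝ)) |>.toLinearEquiv.toLinearMap)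

theorem orthogonalIsometry_mul {n : ℕ} (S T : Matrix.orthogonalGroup (Fin n) ℝ)
    (x : EuclideanSpace ℝ (Fin n)) :
    orthogonalIsometry (S * T) x = orthogonalIsometry S (orthogonalIsometry T x) := by
  change Matrix.toEuclideanCLM (n := Fin n) (𝕜 := ℝ) (S * T).1 x =
    Matrix.toEuclideanCLM (n := Fin n) (𝕜 := ℝ) S.1 (Matrix.toEuclideanCLM (n := Fin n) (𝕜 := ℝ) T.1 x)
  rw [show (S * T).1 = S.1 * T.1 from rfl, map_mul]
  rfl

theorem orthogonalIsometry_one {n : ℕ} (x : EuclideanSpace ℝ (Fin n)) :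
    orthogonalIsometry (1 : Matrix.orthogonalGroup (Fin n) ℝ) x = x := by
  change Matrix.toEuclideanCLM (n := Fin n) (𝕜 := ℝ) 1 x = x
  rw [map_one]
  rfl

theorem orthogonalIsometry_symm_apply {n : ℕ} (T : Matrix.orthogonalGroup (Fin n) ℝ)
    (x : EuclideanSpace ℝ (Fin n)) :
    (orthogonalIsometry T).symm x = orthogonalIsometry T⁻¹ x := by
  rw [LinearIsometryEquiv.symm_apply_eq, ← orthogonalIsometry_mul, mul_inv_cancel,
    orthogonalIsometry_one]

theorem exists_orthogonalIsometry_eq {n : ℕ} (f : EuclideanSpace ℝ (Fin n) ≃ₗᵢ[ℝ] EuclideanSpace ℝ (Fin n)) :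
    ∃ S : Matrix.orthogonalGroup (Fin n) ℝ, ∀ x, orthogonalIsometry S x = f x := by
  set U := Unitary.linearIsometryEquiv.symm f with hU
  have hmem : (Matrix.toEuclideanCLM (n := Fin n) (𝕜 := ℝ)).symm U.1 ∈
      Matrix.orthogonalGroup (Fin n) ℝ :=
    Unitary.map_mem (Matrix.toEuclideanCLM (n := Fin n) (𝕜 := ℝ)).symm U.2
  refine ⟨⟨_, hmem⟩, fun x => ?_⟩
  change Matrix.toEuclideanCLM (n := Fin n) (𝕜 := ℝ)
    ((Matrix.toEuclideanCLM (n := Fin n) (𝕜 := ℝ)).symm U.1) x = f x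
  rw [StarAlgEquiv.apply_symm_apply]
  have : f = Unitary.linearIsometryEquiv U := (MulEquiv.apply_symm_apply _ _).symm
  rw [this]
  rfl

/-- The reflection in the hyperplane orthogonal to `x - y` exchanges the two vectors. -/
theorem exists_orthogonalIsometry_apply_eq {n : ℕ} {x y : EuclideanSpace ℝ (Fin n)}
    (h : ‖x‖ = ‖y‖) : ∃ S : Matrix.orthogonalGroup (Fin n) ℝ, orthogonalIsometry S x = y := by
  obtain ⟨S, hS⟩ := exists_orthogonalIsometry_eq (Submodule.reflection (ℝ ∙ (x - y))ᗮ)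
  exact ⟨S, by rw [hS, Submodule.reflection_sub h]⟩

/-- Since `P_{TE} = T P_E T⁻¹`, the randomness moves from the subspace to the vector being
projected. -/
theorem norm_proj_rotate {n k : ℕ} (E : RealGrassmannian n k)
    (T : Matrix.orthogonalGroup (Fin n) ℝ) (x : EuclideanSpace ℝ (Fin n)) :
    ‖(E.rotate T).proj x‖ = ‖E.proj (orthogonalIsometry T⁻¹ x)‖ := by
  have h := Submodule.starProjection_map_apply (orthogonalIsometry T) E.1 x
  rw [orthogonalIsometry_symm_apply] at h
  have h' : (E.rotate T).proj x = orthogonalIsometry T (E.proj (orthogonalIsometry T⁻¹ x)) := h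
  rw [h', LinearIsometryEquiv.norm_map]

theorem RealGrassmannian.continuous_proj (n k : ℕ) :
    Continuous (RealGrassmannian.proj : RealGrassmannian n k → _) :=
  continuous_induced_dom

theorem RealGrassmannian.measurable_norm_proj (n k : ℕ) :
    Measurable fun z : EuclideanSpace ℝ (Fin n) × RealGrassmannian n k => ‖z.2.proj z.1‖ := by
  have h1 : Measurable fun z : EuclideanSpace ℝ (Fin n) × RealGrassmannian n k => z.2.proj :=
    (RealGrassmannian.continuous_proj n k).measurable.comp measurable_snd
  have h2 : Continuous fun w : (EuclideanSpace ℝ (Fin n) →L[ℝ] EuclideanSpace ℝ (Fin n)) ×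
      EuclideanSpace ℝ (Fin n) => ‖w.1 w.2‖ := by fun_prop
  have h3 := h2.measurable.comp (h1.prodMk measurable_fst)
  exact h3

theorem continuous_orthogonalIsometry_inv (n : ℕ) :
    Continuous fun z : Matrix.orthogonalGroup (Fin n) ℝ × EuclideanSpace ℝ (Fin n) =>
      orthogonalIsometry z.1⁻¹ z.2 := by
  have h : Continuous fun z : Matrix.orthogonalGroup (Fin n) ℝ × EuclideanSpace ℝ (Fin n) =>
      Matrix.toEuclideanCLM (n := Fin n) (𝕜 := ℝ) (star z.1).1 :=
    (continuous_toEuclideanCLM n).comp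
      (continuous_subtype_val.comp (continuous_star.comp continuous_fst))
  exact h.clm_apply continuous_snd

instance (n : ℕ) : SecondCountableTopology (Matrix.orthogonalGroup (Fin n) ℝ) :=
  have : SecondCountableTopology (Matrix (Fin n) (Fin n) ℝ) :=
    inferInstanceAs (SecondCountableTopology (Fin n → Fin n → ℝ))
  TopologicalSpace.Subtype.secondCountableTopology _

instance (n : ℕ) : (orthogonalHaar n).IsMulLeftInvariant := by
  unfold orthogonalHaar
  infer_instance

theorem lintegral_orthogonalHaar_invariant {n : ℕ} (G : EuclideanSpace ℝ (Fin n) → ℝ≥0∞)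
    (S : Matrix.orthogonalGroup (Fin n) ℝ) (x : EuclideanSpace ℝ (Fin n)) :
    ∫⁻ T, G (orthogonalIsometry T⁻¹ (orthogonalIsometry S x)) ∂orthogonalHaar n =
      ∫⁻ T, G (orthogonalIsometry T⁻¹ x) ∂orthogonalHaar n := by
  rw [← lintegral_mul_left_eq_self _ S]
  refine lintegral_congr fun T => ?_
  rw [← orthogonalIsometry_mul, mul_inv_rev, inv_mul_cancel_right]

theorem stdGaussian_singleton_zero {n : ℕ} (hn : 1 ≤ n) :
    stdGaussian (EuclideanSpace ℝ (Fin n)) {0} = 0 := by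
  have : Nonempty (Fin n) := ⟨⟨0, hn⟩⟩
  have := nullSingletonClass_gaussianReal (μ := 0) (v := 1) one_ne_zero
  rw [← map_pi_eq_stdGaussian,
    Measure.map_apply (PiLp.volume_preserving_toLp (Fin n)).measurable (measurableSet_singleton _)]
  have h : (WithLp.toLp 2 : (Fin n → ℝ) → EuclideanSpace ℝ (Fin n)) ⁻¹' {0} = {0} := by
    ext y
    simp
  rw [h]
  exact measure_singleton _

/-- Both sides are averages over the sphere of radius `‖x‖`, but uniqueness of the invariant measure
on it is not invoked. For fixed `g ≠ 0`, Haar invariance allows `x` to be replaced by the multiple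
of `g` of the same length; averaging over `g`, exchanging the integrals and using the rotation
invariance of the Gaussian removes `T`. -/
theorem lintegral_orthogonalHaar_eq_stdGaussian {n : ℕ} (hn : 1 ≤ n)
    {G : EuclideanSpace ℝ (Fin n) → ℝ≥0∞} (hG : Measurable G) (x : EuclideanSpace ℝ (Fin n)) :
    ∫⁻ T, G (orthogonalIsometry T⁻¹ x) ∂orthogonalHaar n =
      ∫⁻ g, G ((‖x‖ / ‖g‖) • g) ∂stdGaussian (EuclideanSpace ℝ (Fin n)) := by
  have hmG : Measurable fun g : EuclideanSpace ℝ (Fin n) => G ((‖x‖ / ‖g‖) • g) := by fun_prop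
  have h0 : ∀ᵐ g ∂stdGaussian (EuclideanSpace ℝ (Fin n)), g ≠ 0 := by
    rw [ae_iff]
    simpa using stdGaussian_singleton_zero hn
  have h1 : ∀ᵐ g ∂stdGaussian (EuclideanSpace ℝ (Fin n)),
      ∫⁻ T, G (orthogonalIsometry T⁻¹ x) ∂orthogonalHaar n =
        ∫⁻ T, G ((‖x‖ / ‖g‖) • orthogonalIsometry T⁻¹ g) ∂orthogonalHaar n := by
    filter_upwards [h0] with g hg
    have hg' : ‖g‖ ≠ 0 := norm_ne_zero_iff.2 hg
    obtain ⟨S, hS⟩ := exists_orthogonalIsometry_apply_eq (x := (‖x‖ / ‖g‖) • g) (y := x) (by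
      rw [norm_smul, norm_div, norm_norm, norm_norm, div_mul_cancel₀ _ hg'])
    conv_lhs => rw [← hS]
    rw [lintegral_orthogonalHaar_invariant]
    simp_rw [map_smul]
  have h2 : ∫⁻ T, G (orthogonalIsometry T⁻¹ x) ∂orthogonalHaar n =
      ∫⁻ g, ∫⁻ T, G ((‖x‖ / ‖g‖) • orthogonalIsometry T⁻¹ g) ∂orthogonalHaar n
        ∂stdGaussian (EuclideanSpace ℝ (Fin n)) := by
    rw [← lintegral_congr_ae h1, lintegral_const, measure_univ, mul_one]
  have hswap : Measurable (Function.uncurry fun (g : EuclideanSpace ℝ (Fin n))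
      (T : Matrix.orthogonalGroup (Fin n) ℝ) =>
        G ((‖x‖ / ‖g‖) • orthogonalIsometry T⁻¹ g)) := by
    have h3 : Measurable fun z : EuclideanSpace ℝ (Fin n) × Matrix.orthogonalGroup (Fin n) ℝ =>
        orthogonalIsometry z.2⁻¹ z.1 := by
      have h := (continuous_orthogonalIsometry_inv n).measurable.comp measurable_swap
      exact h
    have h4 : Measurable fun z : EuclideanSpace ℝ (Fin n) × Matrix.orthogonalGroup (Fin n) ℝ =>
        ‖x‖ / ‖z.1‖ := by fun_prop
    have h5 := hG.comp (h4.smul h3)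
    exact h5
  rw [h2, lintegral_lintegral_swap hswap.aemeasurable]
  have h5 : ∀ T : Matrix.orthogonalGroup (Fin n) ℝ,
      ∫⁻ g, G ((‖x‖ / ‖g‖) • orthogonalIsometry T⁻¹ g) ∂stdGaussian (EuclideanSpace ℝ (Fin n)) =
        ∫⁻ g, G ((‖x‖ / ‖g‖) • g) ∂stdGaussian (EuclideanSpace ℝ (Fin n)) := by
    intro T
    conv_rhs => rw [← stdGaussian_map (orthogonalIsometry T⁻¹),
      lintegral_map hmG (orthogonalIsometry T⁻¹).continuous.measurable]
    simp_rw [LinearIsometryEquiv.norm_map]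
  simp_rw [h5]
  rw [lintegral_const, measure_univ, mul_one]

/-- The norm of the projection of a random vector onto an independent uniformly distributed random
subspace, in terms of a Gaussian vector. -/
theorem map_norm_proj_eq {n k : ℕ} (hn : 1 ≤ n) (hk : k ≤ n)
    (μ : Measure (EuclideanSpace ℝ (Fin n))) [SFinite μ] :
    (μ.prod (grassmannianHaar hk)).map (fun z => ‖z.2.proj z.1‖) =
      (μ.prod (stdGaussian (EuclideanSpace ℝ (Fin n)))).map
        (fun z => ‖z.1‖ / ‖z.2‖ * ‖(RealGrassmannian.standard hk).proj z.2‖) := by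
  have hm1 := RealGrassmannian.measurable_norm_proj n k
  have hP : Measurable fun g : EuclideanSpace ℝ (Fin n) =>
      ‖(RealGrassmannian.standard hk).proj g‖ :=
    (RealGrassmannian.standard hk).proj.continuous.norm.measurable
  have hm2 : Measurable fun z : EuclideanSpace ℝ (Fin n) × EuclideanSpace ℝ (Fin n) =>
      ‖z.1‖ / ‖z.2‖ * ‖(RealGrassmannian.standard hk).proj z.2‖ :=
    (measurable_fst.norm.div measurable_snd.norm).mul (hP.comp measurable_snd)
  refine Measure.ext_of_lintegral _ fun F hF => ?_
  have hF1 : Measurable fun z : EuclideanSpace ℝ (Fin n) × RealGrassmannian n k =>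
      F ‖z.2.proj z.1‖ := by
    have h := hF.comp hm1
    exact h
  have hF2 : Measurable fun z : EuclideanSpace ℝ (Fin n) × EuclideanSpace ℝ (Fin n) =>
      F (‖z.1‖ / ‖z.2‖ * ‖(RealGrassmannian.standard hk).proj z.2‖) := by
    have h := hF.comp hm2
    exact h
  rw [lintegral_map hF hm1, lintegral_map hF hm2, lintegral_prod _ hF1.aemeasurable,
    lintegral_prod _ hF2.aemeasurable]
  refine lintegral_congr fun x => ?_
  have hF1x : Measurable fun E : RealGrassmannian n k => F ‖E.proj x‖ := by
    have h := hF1.comp (measurable_prodMk_left (x := x))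
    exact h
  rw [grassmannianHaar, lintegral_map hF1x (RealGrassmannian.standard hk).continuous_rotate.measurable]
  simp_rw [norm_proj_rotate]
  rw [lintegral_orthogonalHaar_eq_stdGaussian hn
    (G := fun g => F ‖(RealGrassmannian.standard hk).proj g‖) (hF.comp hP)]
  refine lintegral_congr fun g => ?_
  rw [map_smul, norm_smul, norm_div, norm_norm, norm_norm]

theorem norm_sq_proj_standard {n k : ℕ} (hk : k ≤ n) (x : EuclideanSpace ℝ (Fin n)) :
    ‖(RealGrassmannian.standard hk).proj x‖ ^ 2 = ∑ i : Fin k, x (Fin.castLE hk i) ^ 2 := by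
  set b : Fin k → EuclideanSpace ℝ (Fin n) :=
    fun i => EuclideanSpace.basisFun (Fin n) ℝ (Fin.castLE hk i) with hb
  have hon : Orthonormal ℝ b :=
    (EuclideanSpace.basisFun (Fin n) ℝ).orthonormal.comp _ (Fin.castLE_injective hk)
  have hproj : (RealGrassmannian.standard hk).proj x = ∑ i, x (Fin.castLE hk i) • b i := by
    refine Submodule.eq_starProjection_of_mem_of_inner_eq_zero ?_ ?_
    · exact Submodule.sum_mem _ fun i _ =>
        Submodule.smul_mem _ _ (Submodule.subset_span (Set.mem_range_self i))
    · intro w hw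
      replace hw : w ∈ Submodule.span ℝ (Set.range b) := hw
      induction hw using Submodule.span_induction with
      | mem w hw =>
        obtain ⟨j, rfl⟩ := hw
        rw [real_inner_comm, inner_sub_right, hon.inner_right_fintype]
        simp [hb, EuclideanSpace.inner_single_left]
      | zero => exact inner_zero_right _
      | add u v _ _ hu hv => rw [inner_add_right, hu, hv, add_zero]
      | smul c u _ hu => rw [inner_smul_right, hu, mul_zero]
  rw [hproj, ← real_inner_self_eq_norm_sq, hon.inner_sum]
  exact Finset.sum_congr rfl fun i _ => by simp [sq]


/-! ### The limit theorem in the Gaussian representation -/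

/-- The function whose linearization at `0` gives the fluctuations. -/
def deltaFun (p : ℝ) (z : ℝ × ℝ × ℝ × ℝ) : ℝ :=
  (1 + z.1) ^ (1 / 2 : ℝ) * (1 + z.2.1) ^ (1 / 2 : ℝ) *
    ((1 + z.2.2.1) ^ (-(1 / 2) : ℝ) * (1 + z.2.2.2) ^ (-(1 / p)))

/-- The derivative of `deltaFun` at `0`. -/
def deltaFunDeriv (p : ℝ) : ℝ × ℝ × ℝ × ℝ →L[ℝ] ℝ :=
  (1 / 2 : ℝ) • ContinuousLinearMap.fst ℝ ℝ (ℝ × ℝ × ℝ) +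
    (1 / 2 : ℝ) • (ContinuousLinearMap.fst ℝ ℝ (ℝ × ℝ)).comp (ContinuousLinearMap.snd ℝ ℝ (ℝ × ℝ × ℝ)) +
    (-(1 / 2) : ℝ) • ((ContinuousLinearMap.fst ℝ ℝ ℝ).comp
      ((ContinuousLinearMap.snd ℝ ℝ (ℝ × ℝ)).comp (ContinuousLinearMap.snd ℝ ℝ (ℝ × ℝ × ℝ)))) +
    (-(1 / p) : ℝ) • ((ContinuousLinearMap.snd ℝ ℝ ℝ).comp
      ((ContinuousLinearMap.snd ℝ ℝ (ℝ × ℝ)).comp (ContinuousLinearMap.snd ℝ ℝ (ℝ × ℝ × ℝ))))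

theorem deltaFunDeriv_apply (p a b c d : ℝ) :
    deltaFunDeriv p (a, b, c, d) = 1 / 2 * a + 1 / 2 * b - 1 / 2 * c - 1 / p * d := by
  simp [deltaFunDeriv]
  ring

theorem deltaFun_zero (p : ℝ) : deltaFun p 0 = 1 := by
  simp [deltaFun]

theorem measurable_deltaFun (p : ℝ) : Measurable (deltaFun p) := by
  unfold deltaFun
  fun_prop

theorem hasFDerivAt_one_add_rpow {E : Type*} [NormedAddCommGroup E] [NormedSpace ℝ E]
    (l : E →L[ℝ] ℝ) (e : ℝ) : HasFDerivAt (fun z => (1 + l z) ^ e) (e • l) 0 := by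
  have h := (l.hasFDerivAt (x := 0)).const_add 1
  have h2 := h.rpow_const (p := e) (Or.inl (by simp))
  simpa using h2

theorem hasFDerivAt_deltaFun (p : ℝ) : HasFDerivAt (deltaFun p) (deltaFunDeriv p) 0 := by
  have h1 := hasFDerivAt_one_add_rpow (ContinuousLinearMap.fst ℝ ℝ (ℝ × ℝ × ℝ)) (1 / 2)
  have h2 := hasFDerivAt_one_add_rpow
    ((ContinuousLinearMap.fst ℝ ℝ (ℝ × ℝ)).comp (ContinuousLinearMap.snd ℝ ℝ (ℝ × ℝ × ℝ))) (1 / 2)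
  have h3 := hasFDerivAt_one_add_rpow ((ContinuousLinearMap.fst ℝ ℝ ℝ).comp
      ((ContinuousLinearMap.snd ℝ ℝ (ℝ × ℝ)).comp (ContinuousLinearMap.snd ℝ ℝ (ℝ × ℝ × ℝ))))
      (-(1 / 2))
  have h4 := hasFDerivAt_one_add_rpow ((ContinuousLinearMap.snd ℝ ℝ ℝ).comp
      ((ContinuousLinearMap.snd ℝ ℝ (ℝ × ℝ)).comp (ContinuousLinearMap.snd ℝ ℝ (ℝ × ℝ × ℝ))))
      (-(1 / p))
  have h := (h1.mul h2).mul (h3.mul h4)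
  refine h.congr_fderiv ?_
  simp [deltaFunDeriv]
  abel

/-- The probability space carrying the two Gaussian sequences and the mixing variable. -/
abbrev GaussianSpace : Type := ((ℕ → ℝ) × ℝ≥0) × (ℕ → ℝ)

/-- The product measure on `GaussianSpace`. -/
def gaussianSpaceMeasure (p : ℝ) (W : Measure ℝ≥0) : Measure GaussianSpace :=
  ((Measure.infinitePi fun _ : ℕ => pGaussian p).prod W).prod
    (Measure.infinitePi fun _ : ℕ => gaussianReal 0 1)

/-- The representation of `‖P_E X‖` on `GaussianSpace`. -/
def projNorm (p : ℝ) (N K : ℕ) (ω : GaussianSpace) : ℝ :=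
  ((∑ i ∈ Finset.range N, |ω.1.1 i| ^ p + ω.1.2) ^ (1 / p))⁻¹ *
    √(∑ i ∈ Finset.range N, ω.1.1 i ^ 2) / √(∑ i ∈ Finset.range N, ω.2 i ^ 2) *
    √(∑ i ∈ Finset.range K, ω.2 i ^ 2)

theorem measurable_projNorm (p : ℝ) (N K : ℕ) : Measurable (projNorm p N K) := by
  unfold projNorm
  fun_prop

/-- The relative fluctuations of the four sums that enter `projNorm`. -/
def relFluct (p : ℝ) (N K : ℕ) (ω : GaussianSpace) : ℝ × ℝ × ℝ × ℝ :=
  ((N : ℝ)⁻¹ * ∑ i ∈ Finset.range N, centeredSq p (ω.1.1 i),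
    2 * (K : ℝ)⁻¹ * ∑ i ∈ Finset.range K, halfCenteredSq (ω.2 i),
    2 * (N : ℝ)⁻¹ * ∑ i ∈ Finset.range N, halfCenteredSq (ω.2 i),
    (N : ℝ)⁻¹ * ∑ i ∈ Finset.range N, centeredPow p (ω.1.1 i) + (N : ℝ)⁻¹ * (p * ω.1.2))

/-- The entries of `1 + relFluct` are the four sums divided by `N * secondMoment p`, `K`, `N` and `N
/ p`. The prefactor absorbs the powers of these constants except `√K`. -/
theorem projNorm_eq_deltaFun {p : ℝ} (hp : 1 ≤ p) {N K : ℕ} (hN : 1 ≤ N) (hK : 1 ≤ K)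
    (ω : GaussianSpace) :
    (N : ℝ) ^ (1 / p) * √(Real.Gamma (1 / p) / (p ^ (2 / p) * Real.Gamma (3 / p))) *
      projNorm p N K ω = √K * deltaFun p (relFluct p N K ω) := by
  have hp0 : 0 < p := by linarith
  have hN0 : (0 : ℝ) < N := by positivity
  have hK0 : (0 : ℝ) < K := by positivity
  have hm := secondMoment_pos hp
  have hG1 : 0 < Real.Gamma (1 / p) := Real.Gamma_pos_of_pos (by positivity)
  have hG3 : 0 < Real.Gamma (3 / p) := Real.Gamma_pos_of_pos (by positivity)
  set A := ∑ i ∈ Finset.range N, ω.1.1 i ^ 2 with hA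
  set B := ∑ i ∈ Finset.range N, |ω.1.1 i| ^ p + (ω.1.2 : ℝ) with hB
  set C := ∑ i ∈ Finset.range N, ω.2 i ^ 2 with hC
  set D := ∑ i ∈ Finset.range K, ω.2 i ^ 2 with hD
  have hA0 : 0 ≤ A := Finset.sum_nonneg fun i _ => sq_nonneg _
  have hC0 : 0 ≤ C := Finset.sum_nonneg fun i _ => sq_nonneg _
  have hD0 : 0 ≤ D := Finset.sum_nonneg fun i _ => sq_nonneg _
  have hB0 : 0 ≤ B := add_nonneg
    (Finset.sum_nonneg fun i _ => Real.rpow_nonneg (abs_nonneg _) _) ω.1.2.2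
  have ea : 1 + (relFluct p N K ω).1 = A / (N * secondMoment p) := by
    simp only [relFluct, centeredSq, Finset.sum_sub_distrib, ← Finset.sum_div, ← hA,
      Finset.sum_const, Finset.card_range, nsmul_eq_mul]
    field_simp
    ring
  have eb : 1 + (relFluct p N K ω).2.1 = D / K := by
    simp only [relFluct, halfCenteredSq, ← Finset.mul_sum, Finset.sum_sub_distrib, ← hD,
      Finset.sum_const, Finset.card_range, nsmul_eq_mul]
    field_simp
    ring
  have ec : 1 + (relFluct p N K ω).2.2.1 = C / N := by
    simp only [relFluct, halfCenteredSq, ← Finset.mul_sum, Finset.sum_sub_distrib, ← hC,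
      Finset.sum_const, Finset.card_range, nsmul_eq_mul]
    field_simp
    ring
  have ed : 1 + (relFluct p N K ω).2.2.2 = p * B / N := by
    simp only [relFluct, centeredPow, ← Finset.mul_sum, Finset.sum_sub_distrib, hB,
      Finset.sum_const, Finset.card_range, nsmul_eq_mul]
    field_simp
    ring
  rw [deltaFun, ea, eb, ec, ed, projNorm, ← hA, ← hB, ← hC, ← hD, ← Real.sqrt_eq_rpow,
    ← Real.sqrt_eq_rpow, Real.rpow_neg (by positivity), ← Real.sqrt_eq_rpow,
    Real.rpow_neg (by positivity), Real.div_rpow (by positivity) hN0.le,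
    Real.mul_rpow hp0.le hB0, Real.sqrt_div hA0, Real.sqrt_div hD0, Real.sqrt_div hC0,
    Real.sqrt_mul hN0.le, secondMoment, Real.sqrt_div hG3.le, Real.sqrt_div hG1.le,
    Real.sqrt_mul (by positivity)]
  have h2 : √(p ^ (2 / p)) = p ^ (1 / p) := by
    rw [Real.sqrt_eq_rpow, ← Real.rpow_mul hp0.le]
    congr 1
    ring
  rw [h2]
  have s1 := Real.sqrt_pos.2 hN0
  have s2 := Real.sqrt_pos.2 hK0
  have s3 := Real.sqrt_pos.2 hG1
  have s4 := Real.sqrt_pos.2 hG3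
  have s5 : 0 < p ^ (1 / p) := by positivity
  have s6 : 0 < (N : ℝ) ^ (1 / p) := by positivity
  field_simp

theorem measurable_relFluct (p : ℝ) (N K : ℕ) : Measurable (relFluct p N K) := by
  have h1 := measurable_centeredSq p
  have h2 := measurable_centeredPow p
  have h3 := measurable_halfCenteredSq
  unfold relFluct
  fun_prop

/-- The linear part of the fluctuations. -/
def linearFluct (p : ℝ) (N K : ℕ) (ω : GaussianSpace) : ℝ :=
  ∑ i ∈ Finset.range N, √K * (N : ℝ)⁻¹ * fluctuation p (ω.1.1 i) +
    ∑ i ∈ Finset.range N, √K * ((if i < K then (K : ℝ)⁻¹ else 0) - (N : ℝ)⁻¹) *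
      halfCenteredSq (ω.2 i)

/-- The Gaussian coordinates below `K` occur in two of the sums; collecting them gives one sum with
independent terms and weights `1/K - 1/N` or `-1/N`. The mixing variable is split off because its
term vanishes in the limit. -/
theorem deltaFunDeriv_relFluct {p : ℝ} (hp : 1 ≤ p) {N K : ℕ} (hK : K ≤ N) (ω : GaussianSpace) :
    √K * deltaFunDeriv p (relFluct p N K ω) = linearFluct p N K ω + -(√K * (N : ℝ)⁻¹ * ω.1.2) := by
  have hp0 : p ≠ 0 := by linarith
  have h : ∑ i ∈ Finset.range N, (if i < K then (K : ℝ)⁻¹ else 0) * halfCenteredSq (ω.2 i) =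
      ∑ i ∈ Finset.range K, (K : ℝ)⁻¹ * halfCenteredSq (ω.2 i) := by
    rw [← Finset.sum_subset (Finset.range_mono hK)]
    · exact Finset.sum_congr rfl fun i hi => by rw [if_pos (Finset.mem_range.1 hi)]
    · intro i _ hi
      rw [if_neg (by simpa using hi), zero_mul]
  have h' : ∑ i ∈ Finset.range N, √K * ((if i < K then (K : ℝ)⁻¹ else 0) - (N : ℝ)⁻¹) *
      halfCenteredSq (ω.2 i) = √K * (∑ i ∈ Finset.range K, (K : ℝ)⁻¹ * halfCenteredSq (ω.2 i) -
        ∑ i ∈ Finset.range N, (N : ℝ)⁻¹ * halfCenteredSq (ω.2 i)) := by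
    rw [← h, ← Finset.sum_sub_distrib, Finset.mul_sum]
    exact Finset.sum_congr rfl fun i _ => by ring
  rw [linearFluct, h', relFluct, deltaFunDeriv_apply]
  simp only [fluctuation, ← Finset.mul_sum, Finset.sum_sub_distrib]
  field_simp
  ring

theorem measurable_linearFluct (p : ℝ) (N K : ℕ) : Measurable (linearFluct p N K) := by
  have h1 := measurable_fluctuation p
  have h3 := measurable_halfCenteredSq
  unfold linearFluct
  fun_prop

section Limit

variable {p : ℝ} {W : Measure ℝ≥0} [IsProbabilityMeasure W]

theorem isProbabilityMeasure_gaussianSpaceMeasure (hp : 1 ≤ p) :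
    IsProbabilityMeasure (gaussianSpaceMeasure p W) := by
  have := isProbabilityMeasure_pGaussian hp
  unfold gaussianSpaceMeasure
  infer_instance

theorem measurePreserving_fst_fst (hp : 1 ≤ p) :
    MeasurePreserving (fun ω : GaussianSpace => ω.1.1) (gaussianSpaceMeasure p W)
      (Measure.infinitePi fun _ : ℕ => pGaussian p) := by
  have := isProbabilityMeasure_pGaussian hp
  exact measurePreserving_fst.comp measurePreserving_fst

theorem measurePreserving_snd_gaussianSpace (hp : 1 ≤ p) :
    MeasurePreserving (fun ω : GaussianSpace => ω.2) (gaussianSpaceMeasure p W)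
      (Measure.infinitePi fun _ : ℕ => gaussianReal 0 1) := by
  have := isProbabilityMeasure_pGaussian hp
  exact measurePreserving_snd

/-- The two sequences are independent, and the Gaussian product splits at index `K` into two blocks
of constant weight, so each factor is a power to which `tendsto_charFun_pow` applies. -/
theorem charFun_linearFluct (hp : 1 ≤ p) {N K : ℕ} (hK : K ≤ N) (t : ℝ) :
    charFun ((gaussianSpaceMeasure p W).map (linearFluct p N K)) t =
      charFun ((pGaussian p).map (fluctuation p)) (√K * (N : ℝ)⁻¹ * t) ^ N *
      (charFun ((gaussianReal 0 1).map halfCenteredSq) (√K * ((K : ℝ)⁻¹ - (N : ℝ)⁻¹) * t) ^ K *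
        charFun ((gaussianReal 0 1).map halfCenteredSq) (√K * (0 - (N : ℝ)⁻¹) * t) ^ (N - K)) := by
  have := isProbabilityMeasure_pGaussian hp
  have hprob := isProbabilityMeasure_gaussianSpaceMeasure (W := W) hp
  have hf := measurable_fluctuation p
  have hh := measurable_halfCenteredSq
  set A : (ℕ → ℝ) → ℝ := fun y => ∑ i ∈ Finset.range N, √K * (N : ℝ)⁻¹ * fluctuation p (y i)
    with hA
  set B : (ℕ → ℝ) → ℝ := fun g => ∑ i ∈ Finset.range N,
    √K * ((if i < K then (K : ℝ)⁻¹ else 0) - (N : ℝ)⁻¹) * halfCenteredSq (g i) with hB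
  have hAm : Measurable A := by fun_prop
  have hBm : Measurable B := by fun_prop
  have hind : IndepFun (fun ω : GaussianSpace => A ω.1.1) (fun ω : GaussianSpace => B ω.2)
      (gaussianSpaceMeasure p W) :=
    indepFun_prod (X := fun z : (ℕ → ℝ) × ℝ≥0 => A z.1) (hAm.comp measurable_fst) hBm
  have hAmap : (gaussianSpaceMeasure p W).map (fun ω : GaussianSpace => A ω.1.1) =
      (Measure.infinitePi fun _ : ℕ => pGaussian p).map A := by
    rw [← (measurePreserving_fst_fst (W := W) hp).map_eq, Measure.map_map hAm
      (measurePreserving_fst_fst (W := W) hp).measurable]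
    rfl
  have hBmap : (gaussianSpaceMeasure p W).map (fun ω : GaussianSpace => B ω.2) =
      (Measure.infinitePi fun _ : ℕ => gaussianReal 0 1).map B := by
    rw [← (measurePreserving_snd_gaussianSpace (W := W) hp).map_eq, Measure.map_map hBm
      (measurePreserving_snd_gaussianSpace (W := W) hp).measurable]
    rfl
  have h1 := IndepFun.charFun_map_fun_add_eq_mul (X := fun ω : GaussianSpace => A ω.1.1)
    (Y := fun ω : GaussianSpace => B ω.2)
    (hAm.comp (measurePreserving_fst_fst (W := W) hp).measurable).aemeasurable
    (hBm.comp (measurePreserving_snd_gaussianSpace (W := W) hp).measurable).aemeasurable hind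
  have h2 : linearFluct p N K = fun ω : GaussianSpace => A ω.1.1 + B ω.2 := rfl
  rw [h2, h1, Pi.mul_apply, hAmap, hBmap, hA, hB,
    charFun_map_sum_infinitePi _ hf (fun _ => √K * (N : ℝ)⁻¹),
    charFun_map_sum_infinitePi _ hh
      (fun i => √K * ((if i < K then (K : ℝ)⁻¹ else 0) - (N : ℝ)⁻¹)),
    Finset.prod_const, Finset.card_range]
  congr 1
  rw [← Finset.prod_range_mul_prod_Ico _ hK]
  congr 1
  · rw [Finset.prod_congr rfl (g := fun _ => charFun ((gaussianReal 0 1).map halfCenteredSq)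
      (√K * ((K : ℝ)⁻¹ - (N : ℝ)⁻¹) * t)), Finset.prod_const, Finset.card_range]
    intro i hi
    rw [if_pos (Finset.mem_range.1 hi)]
  · rw [Finset.prod_congr rfl (g := fun _ => charFun ((gaussianReal 0 1).map halfCenteredSq)
      (√K * (0 - (N : ℝ)⁻¹) * t)), Finset.prod_const, Nat.card_Ico]
    intro i hi
    rw [if_neg (not_lt.2 (Finset.mem_Ico.1 hi).1)]

theorem boundedInProb_sum_infinitePi {ν : Measure ℝ} [IsProbabilityMeasure ν] {f : ℝ → ℝ}
    (hf : Measurable f) (hm : MemLp f 2 ν) (h0 : ∫ x, f x ∂ν = 0) {c : ℕ → ℝ} {M : ℕ → ℕ} {C : ℝ}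
    (hc : ∀ m, c m ^ 2 * M m ≤ C) :
    BoundedInProb (Measure.infinitePi fun _ : ℕ => ν)
      fun m (ω : ℕ → ℝ) => c m * ∑ i ∈ Finset.range (M m), f (ω i) := by
  refine BoundedInProb.of_variance_le (C := C * variance f ν)
    (fun m => memLp_sum_infinitePi ν hm _ _) (fun m => integral_sum_infinitePi ν hm h0 _ _)
    fun m => ?_
  rw [variance_sum_infinitePi ν hf hm, ← mul_assoc]
  exact mul_le_mul_of_nonneg_right (hc m) (variance_nonneg _ _)

theorem BoundedInProb.comp_measurePreserving {Ω Ω' : Type*} [MeasurableSpace Ω]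
    [MeasurableSpace Ω'] {P : Measure Ω} {P' : Measure Ω'} {X : ℕ → Ω → ℝ}
    (hX : BoundedInProb P X) (hXm : ∀ m, Measurable (X m)) {π : Ω' → Ω}
    (hπ : MeasurePreserving π P' P) : BoundedInProb P' fun m ω => X m (π ω) := by
  intro ε hε
  obtain ⟨M, hM⟩ := hX ε hε
  refine ⟨M, hM.mono fun m hm => ?_⟩
  rw [← hπ.measure_preimage (measurableSet_lt measurable_const (hXm m).norm).nullMeasurableSet]
    at hm
  exact hm

variable {N K : ℕ → ℕ} {lam : ℝ}

/-- The quantity is `√(K / N)`, which converges, times `1 / √N`, which tends to `0`. -/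
theorem tendsto_sqrt_mul_inv (hKN : ∀ m, K m ≤ N m) (hK : Tendsto K atTop atTop)
    (hlim : Tendsto (fun m => (K m : ℝ) / N m) atTop (𝓝 lam)) :
    Tendsto (fun m => √(K m) * (N m : ℝ)⁻¹) atTop (𝓝 0) := by
  have hN : Tendsto (fun m => (N m : ℝ)) atTop atTop :=
    tendsto_natCast_atTop_atTop.comp (tendsto_atTop_mono hKN hK)
  have h := (Real.continuous_sqrt.tendsto lam).comp hlim
  have h2 := h.mul (tendsto_inv_atTop_zero.comp (Real.tendsto_sqrt_atTop.comp hN))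
  rw [mul_zero] at h2
  refine h2.congr fun m => ?_
  simp only [Function.comp_apply]
  rw [Real.sqrt_div (Nat.cast_nonneg _), div_mul_eq_mul_div, mul_div_assoc]
  congr 1
  rw [div_eq_mul_inv, ← mul_inv, Real.mul_self_sqrt (Nat.cast_nonneg _)]

theorem tendstoInDistribution_linearFluct (hp : 1 ≤ p) [IsProbabilityMeasure (gaussianSpaceMeasure p W)]
    (hK1 : ∀ m, 1 ≤ K m) (hKN : ∀ m, K m ≤ N m)
    (hK : Tendsto K atTop atTop) (hlim : Tendsto (fun m => (K m : ℝ) / N m) atTop (𝓝 lam))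
    {v : ℝ≥0} (hv : (v : ℝ) = sigmaSq p lam) :
    TendstoInDistribution (fun m => linearFluct p (N m) (K m)) atTop (id : ℝ → ℝ)
      (fun _ => gaussianSpaceMeasure p W) (gaussianReal 0 v) where
  forall_aemeasurable m := (measurable_linearFluct p _ _).aemeasurable
  aemeasurable_limit := aemeasurable_id
  tendsto := by
    refine ProbabilityMeasure.tendsto_iff_tendsto_charFun.2 fun t => ?_
    have := isProbabilityMeasure_pGaussian hp
    have hmf := measurable_fluctuation p
    have hmh := measurable_halfCenteredSq
    have hF : IsProbabilityMeasure ((pGaussian p).map (fluctuation p)) :=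
      Measure.isProbabilityMeasure_map hmf.aemeasurable
    have hH : IsProbabilityMeasure ((gaussianReal 0 1).map halfCenteredSq) :=
      Measure.isProbabilityMeasure_map hmh.aemeasurable
    have hF2 : MemLp id 2 ((pGaussian p).map (fluctuation p)) :=
      (memLp_map_measure_iff aestronglyMeasurable_id hmf.aemeasurable).2 (memLp_fluctuation hp)
    have hH2 : MemLp id 2 ((gaussianReal 0 1).map halfCenteredSq) :=
      (memLp_map_measure_iff aestronglyMeasurable_id hmh.aemeasurable).2 memLp_halfCenteredSq
    have hF0 : ∫ x, x ∂(pGaussian p).map (fluctuation p) = 0 := by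
      rw [integral_map hmf.aemeasurable (by fun_prop), integral_fluctuation hp]
    have hH0 : ∫ x, x ∂(gaussianReal 0 1).map halfCenteredSq = 0 := by
      rw [integral_map hmh.aemeasurable (by fun_prop), integral_halfCenteredSq]
    have hFs : ∫ x, x ^ 2 ∂(pGaussian p).map (fluctuation p) =
        ∫ x, fluctuation p x ^ 2 ∂pGaussian p := by
      rw [integral_map hmf.aemeasurable (by fun_prop)]
    have hHs : ∫ x, x ^ 2 ∂(gaussianReal 0 1).map halfCenteredSq = 1 / 2 := by
      rw [integral_map hmh.aemeasurable (by fun_prop), integral_halfCenteredSq_sq]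
    have hK0 : ∀ m, (0 : ℝ) < K m := fun m => by exact_mod_cast hK1 m
    have hN0 : ∀ m, (0 : ℝ) < N m := fun m => by exact_mod_cast (hK1 m).trans (hKN m)
    have hc := tendsto_sqrt_mul_inv hKN hK hlim
    have hsqrt : Tendsto (fun m => (√(K m))⁻¹) atTop (𝓝 0) :=
      tendsto_inv_atTop_zero.comp (Real.tendsto_sqrt_atTop.comp
        (tendsto_natCast_atTop_atTop.comp hK))
    -- Here `N c² = (K / N) t²`.
    have l1 : Tendsto (fun m => charFun ((pGaussian p).map (fluctuation p))
        (√(K m) * (N m : ℝ)⁻¹ * t) ^ N m) atTop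
        (𝓝 (Complex.exp (-((∫ x, fluctuation p x ^ 2 ∂pGaussian p : ℝ) *
          ((lam * t ^ 2 : ℝ) : ℂ) / 2 : ℂ)))) := by
      rw [← hFs]
      refine tendsto_charFun_pow hF2 hF0 (by simpa using hc.mul_const t) ?_
      refine (hlim.mul_const (t ^ 2)).congr fun m => ?_
      rw [mul_pow, mul_pow, Real.sq_sqrt (hK0 m).le]
      have := hN0 m
      field_simp
    -- Here `K c² = (1 - K / N)² t²`.
    have l2 : Tendsto (fun m => charFun ((gaussianReal 0 1).map halfCenteredSq)
        (√(K m) * ((K m : ℝ)⁻¹ - (N m : ℝ)⁻¹) * t) ^ K m) atTop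
        (𝓝 (Complex.exp (-(((1 / 2 : ℝ) : ℂ) * (((1 - lam) ^ 2 * t ^ 2 : ℝ) : ℂ) / 2 : ℂ)))) := by
      rw [← hHs]
      refine tendsto_charFun_pow hH2 hH0 ?_ ?_
      · have h := (hsqrt.sub hc).mul_const t
        rw [sub_zero, zero_mul] at h
        refine h.congr fun m => ?_
        have h1 : (√(K m))⁻¹ = √(K m) * (K m : ℝ)⁻¹ := by
          rw [eq_comm, ← div_eq_mul_inv, Real.sqrt_div_self']
          simp
        rw [h1]
        ring
      · refine (((hlim.const_sub 1).pow 2).mul_const (t ^ 2)).congr fun m => ?_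
        rw [mul_pow, mul_pow, Real.sq_sqrt (hK0 m).le]
        have := hN0 m
        have := hK0 m
        field_simp
    -- Here `(N - K) c² = (K / N) (1 - K / N) t²`.
    have l3 : Tendsto (fun m => charFun ((gaussianReal 0 1).map halfCenteredSq)
        (√(K m) * (0 - (N m : ℝ)⁻¹) * t) ^ (N m - K m)) atTop
        (𝓝 (Complex.exp (-(((1 / 2 : ℝ) : ℂ) * ((lam * (1 - lam) * t ^ 2 : ℝ) : ℂ) / 2 : ℂ)))) := by
      rw [← hHs]
      refine tendsto_charFun_pow hH2 hH0 ?_ ?_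
      · have h := hc.neg.mul_const t
        rw [neg_zero, zero_mul] at h
        refine h.congr fun m => ?_
        ring
      · refine ((hlim.mul (hlim.const_sub 1)).mul_const (t ^ 2)).congr fun m => ?_
        rw [mul_pow, mul_pow, Real.sq_sqrt (hK0 m).le, Nat.cast_sub (hKN m)]
        have := hN0 m
        field_simp
        ring
    have hl := l1.mul (l2.mul l3)
    rw [← Complex.exp_add, ← Complex.exp_add] at hl
    simp only [ProbabilityMeasure.coe_mk, Measure.map_id, charFun_gaussianReal]
    simp_rw [charFun_linearFluct hp (hKN _)]
    convert hl using 2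
    rw [show ((v : ℝ) : ℂ) = ((sigmaSq p lam : ℝ) : ℂ) by rw [hv], sigmaSq_eq hp]
    push_cast
    congr 1
    ring

/-- Chebyshev's inequality suffices: after multiplication by `√K` the variances are of order `K / N
≤ 1` for the sums of length `N` and of order `1` for the sum of length `K`. The mixing term tends to
`0` pointwise. -/
theorem boundedInProb_relFluct (hp : 1 ≤ p) (hK1 : ∀ m, 1 ≤ K m) (hKN : ∀ m, K m ≤ N m)
    (hK : Tendsto K atTop atTop) (hlim : Tendsto (fun m => (K m : ℝ) / N m) atTop (𝓝 lam)) :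
    BoundedInProb (gaussianSpaceMeasure p W) fun m ω => √(K m) • relFluct p (N m) (K m) ω := by
  have := isProbabilityMeasure_pGaussian hp
  have hprob := isProbabilityMeasure_gaussianSpaceMeasure (W := W) hp
  have hK0 : ∀ m, (0 : ℝ) < K m := fun m => by exact_mod_cast hK1 m
  have hN0 : ∀ m, (0 : ℝ) < N m := fun m => by exact_mod_cast (hK1 m).trans (hKN m)
  have hle : ∀ m, (K m : ℝ) ≤ N m := fun m => by exact_mod_cast hKN m
  have hc : ∀ m, (√(K m) * (N m : ℝ)⁻¹) ^ 2 * N m ≤ 1 := fun m => by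
    rw [mul_pow, Real.sq_sqrt (hK0 m).le]
    have := hN0 m
    field_simp
    exact hle m
  have hms := measurable_centeredSq p
  have hmp := measurable_centeredPow p
  have hmh := measurable_halfCenteredSq
  have h1 := (boundedInProb_sum_infinitePi hms (memLp_centeredSq hp) (integral_centeredSq hp)
    hc).comp_measurePreserving (fun m => by fun_prop) (measurePreserving_fst_fst (W := W) hp)
  have h4 := (boundedInProb_sum_infinitePi hmp (memLp_centeredPow hp) (integral_centeredPow hp)
    hc).comp_measurePreserving (fun m => by fun_prop) (measurePreserving_fst_fst (W := W) hp)
  have h2 := (boundedInProb_sum_infinitePi hmh memLp_halfCenteredSq integral_halfCenteredSq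
    (c := fun m => 2 * (√(K m) * (K m : ℝ)⁻¹)) (M := K) (C := 4) (fun m => by
      rw [mul_pow, mul_pow, Real.sq_sqrt (hK0 m).le]
      have := hK0 m
      field_simp
      norm_num)).comp_measurePreserving (fun m => by fun_prop)
        (measurePreserving_snd_gaussianSpace (W := W) hp)
  have h3 := (boundedInProb_sum_infinitePi hmh memLp_halfCenteredSq integral_halfCenteredSq
    (c := fun m => 2 * (√(K m) * (N m : ℝ)⁻¹)) (M := N) (C := 4) (fun m => by
      rw [mul_pow, mul_assoc]
      linarith [hc m])).comp_measurePreserving (fun m => by fun_prop)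
        (measurePreserving_snd_gaussianSpace (W := W) hp)
  have h5 : BoundedInProb (gaussianSpaceMeasure p W)
      fun m (ω : GaussianSpace) => √(K m) * (N m : ℝ)⁻¹ * (p * (ω.1.2 : ℝ)) := by
    refine BoundedInProb.of_tendsto_zero (fun m => by fun_prop) fun ω => ?_
    simpa using (tendsto_sqrt_mul_inv hKN hK hlim).mul_const (p * (ω.1.2 : ℝ))
  have h := h1.prodMk (h2.prodMk (h3.prodMk (h4.add h5)))
  have he : (fun m (ω : GaussianSpace) => √(K m) • relFluct p (N m) (K m) ω) = fun m ω =>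
      (√(K m) * (N m : ℝ)⁻¹ * ∑ i ∈ Finset.range (N m), centeredSq p (ω.1.1 i),
        2 * (√(K m) * (K m : ℝ)⁻¹) * ∑ i ∈ Finset.range (K m), halfCenteredSq (ω.2 i),
        2 * (√(K m) * (N m : ℝ)⁻¹) * ∑ i ∈ Finset.range (N m), halfCenteredSq (ω.2 i),
        √(K m) * (N m : ℝ)⁻¹ * ∑ i ∈ Finset.range (N m), centeredPow p (ω.1.1 i) +
          √(K m) * (N m : ℝ)⁻¹ * (p * (ω.1.2 : ℝ))) := by
    funext m ω
    simp only [relFluct, Prod.smul_mk, smul_eq_mul]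
    refine Prod.ext ?_ (Prod.ext ?_ (Prod.ext ?_ ?_)) <;> simp only <;> ring
  rw [he]
  exact h

/-- Slutsky's theorem is applied twice: the quantity is exactly `linearFluct` plus the mixing term
plus the delta-method remainder, and the last two tend to `0` in measure. -/
theorem tendstoInDistribution_projNorm (hp : 1 ≤ p) [IsProbabilityMeasure (gaussianSpaceMeasure p W)]
    (hK1 : ∀ m, 1 ≤ K m) (hKN : ∀ m, K m ≤ N m)
    (hK : Tendsto K atTop atTop) (hlim : Tendsto (fun m => (K m : ℝ) / N m) atTop (𝓝 lam))
    {v : ℝ≥0} (hv : (v : ℝ) = sigmaSq p lam) :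
    TendstoInDistribution (fun m ω => (N m : ℝ) ^ (1 / p) *
        √(Real.Gamma (1 / p) / (p ^ (2 / p) * Real.Gamma (3 / p))) * projNorm p (N m) (K m) ω -
          √(K m)) atTop (id : ℝ → ℝ) (fun _ => gaussianSpaceMeasure p W) (gaussianReal 0 v) := by
  have hL := tendstoInDistribution_linearFluct (W := W) hp hK1 hKN hK hlim hv
  have hD : TendstoInMeasure (gaussianSpaceMeasure p W)
      (fun m (ω : GaussianSpace) => -(√(K m) * (N m : ℝ)⁻¹ * ω.1.2)) atTop (fun _ => (0 : ℝ)) := by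
    refine tendstoInMeasure_of_tendsto_ae (fun m => ?_) (Eventually.of_forall fun ω => ?_)
    · exact (by fun_prop : Measurable fun ω : GaussianSpace =>
        -(√(K m) * (N m : ℝ)⁻¹ * (ω.1.2 : ℝ))).aestronglyMeasurable
    · simpa using ((tendsto_sqrt_mul_inv hKN hK hlim).mul_const (ω.1.2 : ℝ)).neg
  have hr : Tendsto (fun m => √(K m : ℝ)) atTop atTop :=
    Real.tendsto_sqrt_atTop.comp (tendsto_natCast_atTop_atTop.comp hK)
  have hR := tendstoInMeasure_deltaMethod (hasFDerivAt_deltaFun p) hr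
    (boundedInProb_relFluct (W := W) hp hK1 hKN hK hlim)
  have hmR : ∀ m, Measurable fun ω : GaussianSpace =>
      √(K m) * (deltaFun p (relFluct p (N m) (K m) ω) - deltaFun p 0 -
        deltaFunDeriv p (relFluct p (N m) (K m) ω)) := fun m => by
    have h1 := measurable_relFluct p (N m) (K m)
    have h2 := (measurable_deltaFun p).comp h1
    have h3 := (deltaFunDeriv p).continuous.measurable.comp h1
    have h4 := ((h2.sub_const (deltaFun p 0)).sub h3).const_mul √(K m)
    exact h4
  have h1 := hL.add_of_tendstoInMeasure_const hD fun m =>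
    (by fun_prop : Measurable fun ω : GaussianSpace =>
      -(√(K m) * (N m : ℝ)⁻¹ * (ω.1.2 : ℝ))).aemeasurable
  have h2 := h1.add_of_tendstoInMeasure_const hR fun m => (hmR m).aemeasurable
  have he : ∀ m, (fun ω : GaussianSpace => (N m : ℝ) ^ (1 / p) *
        √(Real.Gamma (1 / p) / (p ^ (2 / p) * Real.Gamma (3 / p))) * projNorm p (N m) (K m) ω -
          √(K m)) = linearFluct p (N m) (K m) +
      (fun ω : GaussianSpace => -(√(K m) * (N m : ℝ)⁻¹ * (ω.1.2 : ℝ))) +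
      fun ω => √(K m) * (deltaFun p (relFluct p (N m) (K m) ω) - deltaFun p 0 -
        deltaFunDeriv p (relFluct p (N m) (K m) ω)) := by
    intro m
    funext ω
    have h3 := deltaFunDeriv_relFluct hp (hKN m) ω
    rw [projNorm_eq_deltaFun hp ((hK1 m).trans (hKN m)) (hK1 m), deltaFun_zero]
    simp only [Pi.add_apply]
    rw [← h3]
    ring
  have he' := funext he
  rw [he']
  simpa using! h2

end Limit


/-! ### Reduction to the Gaussian representation -/

/-- The first `n` terms of a sequence, as a vector of `ℝⁿ`. -/
def truncate (n : ℕ) (y : ℕ → ℝ) : EuclideanSpace ℝ (Fin n) :=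
  WithLp.toLp 2 fun i : Fin n => y i

theorem measurable_truncate (n : ℕ) : Measurable (truncate n) :=
  (PiLp.volume_preserving_toLp (Fin n)).measurable.comp (by fun_prop)

/-- One i.i.d. sequence serves all dimensions, so a single probability space carries the
representation for every `n`. -/
theorem measurePreserving_truncate (n : ℕ) (ν : Measure ℝ) [IsProbabilityMeasure ν] :
    MeasurePreserving (truncate n) (Measure.infinitePi fun _ : ℕ => ν)
      ((Measure.pi fun _ : Fin n => ν).map (WithLp.toLp 2)) := by
  refine ⟨measurable_truncate n, ?_⟩
  have h : (Measure.infinitePi fun _ : ℕ => ν).map (fun ω (i : Fin n) => ω i) =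
      Measure.infinitePi fun _ : Fin n => ν :=
    Measure.map_infinitePi_infinitePi_of_inj (P := fun _ : ℕ => ν)
      (f := fun i : Fin n => (i : ℕ)) Fin.val_injective
  have h' : (Measure.infinitePi fun _ : Fin n => ν) = Measure.pi fun _ : Fin n => ν :=
    Measure.infinitePi_eq_pi _
  rw [h'] at h
  rw [← h, Measure.map_map (PiLp.volume_preserving_toLp (Fin n)).measurable (by fun_prop)]
  rfl

theorem norm_truncate (n : ℕ) (y : ℕ → ℝ) :
    ‖truncate n y‖ = √(∑ i ∈ Finset.range n, y i ^ 2) := by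
  rw [EuclideanSpace.norm_eq]
  simp only [truncate, Real.norm_eq_abs, sq_abs]
  rw [Fin.sum_univ_eq_sum_range (fun i => y i ^ 2)]

theorem ellNorm_truncate_rpow {p : ℝ} (hp : 1 ≤ p) (n : ℕ) (y : ℕ → ℝ) :
    ellNorm p (truncate n y) ^ p = ∑ i ∈ Finset.range n, |y i| ^ p := by
  rw [ellNorm_rpow hp]
  simp only [truncate]
  rw [Fin.sum_univ_eq_sum_range (fun i => |y i| ^ p)]

theorem norm_proj_standard_truncate {n k : ℕ} (hk : k ≤ n) (g : ℕ → ℝ) :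
    ‖(RealGrassmannian.standard hk).proj (truncate n g)‖ = √(∑ i ∈ Finset.range k, g i ^ 2) := by
  rw [← Real.sqrt_sq (norm_nonneg _), norm_sq_proj_standard]
  simp only [truncate, Fin.val_castLE]
  rw [Fin.sum_univ_eq_sum_range (fun i => g i ^ 2)]

theorem measurePreserving_representation {p : ℝ} (hp : 1 ≤ p) {n : ℕ} (hn : 1 ≤ n)
    (W : Measure ℝ≥0) [IsProbabilityMeasure W] :
    MeasurePreserving
      (fun ω : GaussianSpace => (lpNormalize p (truncate n ω.1.1) ω.1.2, truncate n ω.2))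
      (gaussianSpaceMeasure p W)
      ((lpLaw n p W).prod (stdGaussian (EuclideanSpace ℝ (Fin n)))) := by
  have := isProbabilityMeasure_pGaussian hp
  have hpi := isProbabilityMeasure_map_toLp_pi_pGaussian hp n
  have h1 : MeasurePreserving (Prod.map (truncate n) (id : ℝ≥0 → ℝ≥0))
      ((Measure.infinitePi fun _ : ℕ => pGaussian p).prod W)
      (((Measure.pi fun _ : Fin n => pGaussian p).map (WithLp.toLp 2)).prod W) :=
    (measurePreserving_truncate n (pGaussian p)).prod (MeasurePreserving.id W)
  have h2 : MeasurePreserving (fun z : EuclideanSpace ℝ (Fin n) × ℝ≥0 => lpNormalize p z.1 z.2)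
      (((Measure.pi fun _ : Fin n => pGaussian p).map (WithLp.toLp 2)).prod W) (lpLaw n p W) :=
    ⟨measurable_lpNormalize p, map_lpNormalize hn hp W⟩
  have h3 := measurePreserving_truncate n (gaussianReal 0 1)
  rw [map_pi_eq_stdGaussian] at h3
  have hlaw : IsProbabilityMeasure (lpLaw n p W) := by
    rw [← map_lpNormalize hn hp W]
    exact Measure.isProbabilityMeasure_map (measurable_lpNormalize p).aemeasurable
  have h4 := (h2.comp h1).prod h3
  exact h4

/-- Independence turns the joint law into a product, `map_norm_proj_eq` trades the subspace for a
Gaussian vector, and `measurePreserving_representation` pulls everything back to `GaussianSpace`. -/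
theorem map_norm_proj_eq_map_projNorm {p : ℝ} (hp : 1 ≤ p) {n k : ℕ} (hn : 1 ≤ n) (hk : k ≤ n)
    (W : Measure ℝ≥0) [IsProbabilityMeasure W] {Ω : Type*} [MeasurableSpace Ω] {P : Measure Ω}
    [IsProbabilityMeasure P] {X : Ω → EuclideanSpace ℝ (Fin n)} (hX : HasLaw X (lpLaw n p W) P)
    {E : Ω → RealGrassmannian n k} (hE : HasLaw E (grassmannianHaar hk) P) (hXE : IndepFun X E P) :
    P.map (fun ω => ‖(E ω).proj (X ω)‖) = (gaussianSpaceMeasure p W).map (projNorm p n k) := by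
  have hlaw : IsProbabilityMeasure (lpLaw n p W) := by
    rw [← hX.map_eq]
    exact Measure.isProbabilityMeasure_map hX.aemeasurable
  have hm1 := RealGrassmannian.measurable_norm_proj n k
  have hrep := measurePreserving_representation hp hn W
  have hP : Measurable fun g : EuclideanSpace ℝ (Fin n) =>
      ‖(RealGrassmannian.standard hk).proj g‖ :=
    (RealGrassmannian.standard hk).proj.continuous.norm.measurable
  have hm2 : Measurable fun z : EuclideanSpace ℝ (Fin n) × EuclideanSpace ℝ (Fin n) =>
      ‖z.1‖ / ‖z.2‖ * ‖(RealGrassmannian.standard hk).proj z.2‖ :=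
    (measurable_fst.norm.div measurable_snd.norm).mul (hP.comp measurable_snd)
  have hXE' := (indepFun_iff_map_prod_eq_prod_map_map hX.aemeasurable hE.aemeasurable).1 hXE
  rw [hX.map_eq, hE.map_eq] at hXE'
  have h1 := AEMeasurable.map_map_of_aemeasurable (μ := P) (f := fun ω => (X ω, E ω))
    hm1.aemeasurable (hX.aemeasurable.prodMk hE.aemeasurable)
  rw [hXE', map_norm_proj_eq hn hk, ← hrep.map_eq, Measure.map_map hm2 hrep.measurable] at h1
  refine h1.symm.trans ?_
  congr 1
  funext ω
  simp only [Function.comp_apply]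
  have hS : 0 ≤ ∑ i ∈ Finset.range n, |ω.1.1 i| ^ p + (ω.1.2 : ℝ) := add_nonneg
    (Finset.sum_nonneg fun i _ => Real.rpow_nonneg (abs_nonneg _) _) ω.1.2.2
  rw [lpNormalize, norm_smul, norm_truncate, norm_truncate, norm_proj_standard_truncate,
    ellNorm_truncate_rpow hp, projNorm, Real.norm_of_nonneg (inv_nonneg.2 (Real.rpow_nonneg hS _))]

end

/-! ### The limit theorem for the original vectors. -/

theorem theorem1 (p : ℝ) (hp : 1 ≤ p)
    (W : Measure ℝ≥0) [IsProbabilityMeasure W]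
    (k : ℕ+ → ℕ) (hk1 : ∀ n, 1 ≤ k n) (hkn : ∀ n : ℕ+, k n ≤ n)
    {Ω : Type*} [MeasurableSpace Ω] (P : Measure Ω) [IsProbabilityMeasure P]
    (X : ∀ n : ℕ+, Ω → EuclideanSpace ℝ (Fin n))
    (hX : ∀ n : ℕ+, HasLaw (X n) (lpLaw n p W) P)
    (E : ∀ n : ℕ+, Ω → RealGrassmannian n (k n))
    (hE : ∀ n : ℕ+, HasLaw (E n) (grassmannianHaar (hkn n)) P)
    (hXE : ∀ n : ℕ+, IndepFun (X n) (E n) P)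
    (lam : ℝ) (hlam : lam ∈ Set.Icc (0 : ℝ) 1)
    (hk_top : Tendsto k atTop atTop)
    (hk_lim : Tendsto (fun n : ℕ+ => (k n : ℝ) / (n : ℝ)) atTop (𝓝 lam)) :
    ∃ v : ℝ≥0, (v : ℝ) = sigmaSq p lam ∧
      TendstoInDistribution
        (fun (n : ℕ+) (ω : Ω) =>
          (n : ℝ) ^ (1 / p) *
              √(Real.Gamma (1 / p) / (p ^ (2 / p) * Real.Gamma (3 / p))) *
              ‖(E n ω).proj (X n ω)‖ - √(k n : ℝ))
        atTop (id : ℝ → ℝ) (fun _ => P) (gaussianReal 0 v) := by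
  obtain ⟨v, hv⟩ : ∃ v : ℝ≥0, (v : ℝ) = sigmaSq p lam := ⟨⟨_, sigmaSq_nonneg hp hlam⟩, rfl⟩
  refine ⟨v, hv, ?_⟩
  have hprob := isProbabilityMeasure_gaussianSpaceMeasure (W := W) hp
  -- The limit theorem on `GaussianSpace` is indexed by `ℕ`; the order isomorphism with `ℕ+`
  -- transports it in both directions.
  have he : Tendsto (OrderIso.pnatIsoNat.symm : ℕ → ℕ+) atTop atTop :=
    OrderIso.pnatIsoNat.symm.tendsto_atTop
  have he' : Tendsto (OrderIso.pnatIsoNat : ℕ+ → ℕ) atTop atTop := OrderIso.pnatIsoNat.tendsto_atTop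
  have hlim := tendstoInDistribution_projNorm (W := W)
    (N := fun m => (OrderIso.pnatIsoNat.symm m : ℕ)) (K := fun m => k (OrderIso.pnatIsoNat.symm m))
    hp (fun m => hk1 _) (fun m => hkn _) (hk_top.comp he) (hk_lim.comp he) hv
  have hm1 : ∀ n : ℕ+, AEMeasurable (fun ω => ‖(E n ω).proj (X n ω)‖) P := fun n => by
    have h := (RealGrassmannian.measurable_norm_proj n (k n)).comp_aemeasurable
      ((hX n).aemeasurable.prodMk (hE n).aemeasurable)
    exact h
  have hm2 : ∀ n : ℕ+, AEMeasurable (fun ω => (n : ℝ) ^ (1 / p) *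
      √(Real.Gamma (1 / p) / (p ^ (2 / p) * Real.Gamma (3 / p))) *
        ‖(E n ω).proj (X n ω)‖ - √(k n : ℝ)) P := fun n => ((hm1 n).const_mul _).sub_const _
  refine ⟨hm2, aemeasurable_id, ?_⟩
  -- Convergence in distribution involves only the law for each single `n`, so equality of these
  -- laws suffices, whatever the joint law of the original vectors.
  refine (hlim.tendsto.comp he').congr fun n => ?_
  refine Subtype.ext ?_
  have hmF : Measurable fun x : ℝ => (n : ℝ) ^ (1 / p) *
      √(Real.Gamma (1 / p) / (p ^ (2 / p) * Real.Gamma (3 / p))) * x - √(k n : ℝ) := by fun_prop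
  have h0 : P.map (fun ω => ‖(E n ω).proj (X n ω)‖) =
      (gaussianSpaceMeasure p W).map (projNorm p n (k n)) := by
    have h := map_norm_proj_eq_map_projNorm hp n.2 (hkn n) W (hX n) (hE n) (hXE n)
    exact h
  have h1 := AEMeasurable.map_map_of_aemeasurable hmF.aemeasurable (hm1 n)
  rw [h0, Measure.map_map hmF (measurable_projNorm p n (k n))] at h1
  -- A separate index `m = n` absorbs the round trip through `ℕ`, so that one substitution changes
  -- all its occurrences.
  have h2 : ∀ m : ℕ+, m = n → (gaussianSpaceMeasure p W).map (fun ω => (m : ℝ) ^ (1 / p) *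
      √(Real.Gamma (1 / p) / (p ^ (2 / p) * Real.Gamma (3 / p))) * projNorm p m (k m) ω -
        √(k m : ℝ)) = P.map (fun ω => (n : ℝ) ^ (1 / p) *
      √(Real.Gamma (1 / p) / (p ^ (2 / p) * Real.Gamma (3 / p))) * ‖(E n ω).proj (X n ω)‖ -
        √(k n : ℝ)) := by
    rintro _ rfl
    exact h1
  exact h2 _ (OrderIso.pnatIsoNat.symm_apply_apply n)
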